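/- **Setting.** An affinity system on $V=\{1,\dots,n\}$ gives each member $i$ a strict ranking $\pi_i$ of $V$; $\pi_i(1:k)$ is the set of the $k$ first members of $\pi_i$ (all of $V$ if $k\ge n$). Let $\theta>0$, $0\le\beta<\alpha\le1$, $\gamma=\alpha-\beta$. A set $S\subseteq V$ is a $(\theta,\alpha,\beta)$-community if, with $k=\lceil\theta|S|\rceil$, each $i\in S$ lies in $\pi_s(1:k)$ for at least $\alpha|S|$ members $s\in S$, and each $j\notin S$ for at most $\beta|S|$ members $s\in S$. For a size $t\ge1$ put $k=\lceil\theta t\rceil$ and $\kappa=k/t$ (so $\kappa=\theta$ if $\theta t$ is an integer). $R(v)$ is a uniformly random element of $\pi_v(1:k)$, and $R(R(v))$ is obtained by two independent such steps. A member $v$ of a community $S$ with $|S|=t\geq 1$ is a *good seed* for $S$ if $\Pr[R(R(v))=u]\ge\frac{(\alpha-1/2)/\kappa^2}{t}$ for all $u\in S$. *Purification* of a set $S_1\subseteq V$ with parameters $k_2,N_2$: repeat $N_2$ times independently: draw $k_2$ independent uniform elements $U$ of $S_1$; let $S_2$ be the set of $i\in S_1$ with $i\in\pi_u(1:k)$ for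 at least $(\alpha-\gamma/2)k_2$ of the $u$ in $U$ (with multiplicity); let $S_3$ be the set of $i\in V$ with $i\in\pi_s(1:k)$ for at least $(\alpha-\gamma/2)|S_2|$ members $s\in S_2$ (if $S_1=\emptyset$, let $S_3=\emptyset$). The output is the list of those $S_3$ that are $(\theta,\alpha,\beta)$-communities. **Theorem.** Let $1/2<\alpha\le 1$, $0\le\beta<\alpha$, $\theta>0$, $0<\delta<1$, and let $S$ be a nonempty $(\theta,\alpha,\beta)$-community of size $t$ in an affinity system. 1. At least $(2\alpha-1)t$ members of $S$ are good seeds for $S$. 2. There is a universal constant $C>0$ such that, for $k_2=\left\lceil \frac{C}{\gamma^2}\log\frac{\kappa}{\delta\gamma(\alpha-1/2)}\right\rceil$ and $N_2=\left\lceil C\left(\frac{\kappa^2}{\alpha-1/2}\right)^{k_2}\log\frac1\delta\right\rceil$, the following holds for each good seed $v$ of $S$: the set $S_1=\{u:\Pr[R(R(v))=u]\ge\frac{(\alpha-1/2)/\kappa^2}{t}\}$ contains $S$, has size at most $\frac{\kappa^2t}{\alpha-1/2}$, and its purification outputs a list containing $S$ with probability at least $1-\delta$. 3. Let $S_1$ instead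 be the set of all $u$ hit at least $4\log(2t/\delta)$ times by $\left\lceil\frac{8\kappa^2t}{\alpha-1/2}\log\frac{2t}\delta\right\rceil$ independent draws from $R(R(v))$. Then always $|S_1|\le\frac{2\kappa^2t}{\alpha-1/2}+1$, and if $v$ is a good seed of $S$, then $S\subseteq S_1$ with probability at least $1-\delta/2$. 4. There is a universal constant $C>0$ such that, for $k_2=\left\lceil \frac{C}{\gamma^2}\log\frac{\kappa}{\delta\gamma(\alpha-1/2)}\right\rceil$ and $N_2=\left\lceil\left(\frac{C\kappa^2}{\alpha-1/2}\right)^{k_2}\log\frac2\delta\right\rceil$: if $v$ is uniform in $S$, then computing $S_1$ by sampling as in 3 and purifying it outputs a list containing $S$ with probability at least $(2\alpha-1)(1-\delta)$. 5. If $\alpha,\beta,\theta,\delta$ are constants, a local algorithm finds $S$ in time $O(t\log t)$. More precisely, for all $\theta,\alpha,\beta,\delta$ as above there are a randomized program $P$, a real $C$ and an integer $N$ (depending on $\theta,\alpha,\beta,\delta$ only) such that on every affinity system, for every seed $v$ and every $t\ge1$, given $v$, $t$ and $\min(\lceil\theta t\rceil,n)$, the program $P$ always halts after at most $C(t\log t+1)$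 steps with a list of at most $N$ sets; and if $S$ is a $(\theta,\alpha,\beta)$-community of size $t$ and $v$ is uniform in $S$, then the list contains $S$ with probability at least $(2\alpha-1)(1-\delta)$. Here programs are run on a unit-cost random access machine over the natural numbers (memory initially $0$; addition, truncated subtraction, indirect addressing, branching, counted loops, writing elements to the output) that can, in one step, draw a uniform number below a given number, and ask a member it already knows (the seed, or the answer to an earlier question) who is at a given position of its ranking. -/

import Mathlib

/-! ## Affinity systems and self-determined communities

An affinity system on the `n` members `Fin n` is a family `π : Fin n → Equiv.Perm (Fin n)`:
`π i r` is the member that `i` ranks at position `r` (position `0` is the most preferred). -/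

namespace Affinity

open scoped Classical ENNReal

noncomputable section

/-- The `k` most preferred members of `i`, i.e. `π_i(1:k)` (all members if `k ≥ n`). -/
def top {n : ℕ} (π : Fin n → Equiv.Perm (Fin n)) (k : ℕ) (i : Fin n) : Finset (Fin n) :=
  Finset.univ.filter fun j => ((π i).symm j : ℕ) < k

/-- The number of members of `S` that place `j` among their `k` most preferred members. -/
def votes {n : ℕ} (π : Fin n → Equiv.Perm (Fin n)) (k : ℕ) (S : Finset (Fin n)) (j : Fin n) : ℕ :=
  (S.filter fun s => j ∈ top π k s).card

/-- The number `⌈θ t⌉` of votes that a member casts with respect to a community of size `t`. -/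
def quota (θ : ℝ) (t : ℕ) : ℕ := ⌈θ * t⌉₊

/-- `S` is a `(θ, α, β)` self-determined community. -/
structure IsCommunity {n : ℕ} (π : Fin n → Equiv.Perm (Fin n)) (θ α β : ℝ)
    (S : Finset (Fin n)) : Prop where
  inside : ∀ i ∈ S, α * S.card ≤ votes π (quota θ S.card) S i
  outside : ∀ j, j ∉ S → (votes π (quota θ S.card) S j : ℝ) ≤ β * S.card

/-! ## Random choices -/

/-- The probability of the event `E`. -/
def prob {Ω : Type*} (p : PMF Ω) (E : Set Ω) : ℝ≥0∞ := p.toOuterMeasure E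

/-- `m` independent draws from `p`. -/
def iid {Ω : Type*} (p : PMF Ω) : ℕ → PMF (List Ω)
  | 0 => PMF.pure []
  | m + 1 => p.bind fun a => (iid p m).map fun l => a :: l

/-- `R(v)`: a uniformly random element of `π_v(1:k)`. (The second case is only met for `k = 0`.) -/
def vote {n : ℕ} (π : Fin n → Equiv.Perm (Fin n)) (k : ℕ) (v : Fin n) : PMF (Fin n) :=
  if h : (top π k v).Nonempty then PMF.uniformOfFinset (top π k v) h else PMF.pure v

/-- The two-step vote walk `R(R(v))`. -/
def walk {n : ℕ} (π : Fin n → Equiv.Perm (Fin n)) (k : ℕ) (v : Fin n) : PMF (Fin n) :=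
  (vote π k v).bind (vote π k)

/-! ## The local algorithm -/

/-- `⌈θ t⌉ / t`: the number of votes per member relative to `t`. It is `θ` whenever `θ t` is a
positive integer. -/
def ratio (θ : ℝ) (t : ℕ) : ℝ := quota θ t / t

/-- The probability threshold `((α - 1/2) / θ²) / t` of the rough approximation, with `ratio θ t`
for `θ`. -/
def threshold (θ α : ℝ) (t : ℕ) : ℝ := (α - 1 / 2) / ratio θ t ^ 2 / t

/-- The good seed vertices of `S`: the members of `S` whose two-step vote walk hits every member of
`S` with at least the threshold probability. -/
def goodSeeds {n : ℕ} (π : Fin n → Equiv.Perm (Fin n)) (θ α : ℝ) (S : Finset (Fin n)) :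
    Finset (Fin n) :=
  S.filter fun v => ∀ u ∈ S,
    threshold θ α S.card ≤ (walk π (quota θ S.card) v u).toReal

/-- The rough approximation `S₁` obtained from the exact law of `R(R(v))`. -/
def rough {n : ℕ} (π : Fin n → Equiv.Perm (Fin n)) (θ α : ℝ) (t : ℕ) (v : Fin n) :
    Finset (Fin n) :=
  Finset.univ.filter fun u => threshold θ α t ≤ (walk π (quota θ t) v u).toReal

/-- The number of draws from `R(R(v))` when `S₁` is found by sampling. -/
def numDraws (θ α δ : ℝ) (t : ℕ) : ℕ :=
  ⌈8 * ratio θ t ^ 2 * t / (α - 1 / 2) * Real.log (2 * t / δ)⌉₊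

/-- The rough approximation `S₁` obtained from a list `w` of draws from `R(R(v))`: the elements hit
at least `4 log (2 t / δ)` times. -/
def hitSet {n : ℕ} (δ : ℝ) (t : ℕ) (w : List (Fin n)) : Finset (Fin n) :=
  Finset.univ.filter fun u => 4 * Real.log (2 * t / δ) ≤ (w.count u : ℝ)

/-- The points of `S₁` voted for by at least an `α - γ/2` fraction of the list `U`, `γ = α - β`. -/
def refine {n : ℕ} (π : Fin n → Equiv.Perm (Fin n)) (θ α β : ℝ) (t : ℕ) (S₁ : Finset (Fin n))
    (U : List (Fin n)) : Finset (Fin n) :=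
  S₁.filter fun i =>
    (α - (α - β) / 2) * U.length ≤ (U.countP fun u => decide (i ∈ top π (quota θ t) u) : ℝ)

/-- The points of `V` voted for by at least an `α - γ/2` fraction of `S₂`, `γ = α - β`. -/
def recover {n : ℕ} (π : Fin n → Equiv.Perm (Fin n)) (θ α β : ℝ) (t : ℕ) (S₂ : Finset (Fin n)) :
    Finset (Fin n) :=
  Finset.univ.filter fun i =>
    (α - (α - β) / 2) * S₂.card ≤ (votes π (quota θ t) S₂ i : ℝ)

/-- One iteration of the purification procedure: `k₂` independent uniform points of `S₁` are drawn,
and `S₃` is returned. -/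
def purifyOnce {n : ℕ} (π : Fin n → Equiv.Perm (Fin n)) (θ α β : ℝ) (t k₂ : ℕ)
    (S₁ : Finset (Fin n)) : PMF (Finset (Fin n)) :=
  if h : S₁.Nonempty then
    (iid (PMF.uniformOfFinset S₁ h) k₂).map fun U =>
      recover π θ α β t (refine π θ α β t S₁ U)
  else PMF.pure ∅

/-- `N` independent iterations of the purification procedure, followed by the removal of the sets
that are not self-determined communities. -/
def purify {n : ℕ} (π : Fin n → Equiv.Perm (Fin n)) (θ α β : ℝ) (t k₂ N : ℕ)
    (S₁ : Finset (Fin n)) : PMF (List (Finset (Fin n))) :=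
  (iid (purifyOnce π θ α β t k₂ S₁) N).map fun L =>
    L.filter fun A => decide (IsCommunity π θ α β A)

/-- The local algorithm with seed `v`, whose rough approximation is found by sampling. -/
def sampledLocal {n : ℕ} (π : Fin n → Equiv.Perm (Fin n)) (θ α β δ : ℝ) (t k₂ N : ℕ) (v : Fin n) :
    PMF (List (Finset (Fin n))) :=
  (iid (walk π (quota θ t) v) (numDraws θ α δ t)).bind fun w =>
    purify π θ α β t k₂ N (hitSet δ t w)

/-- `⌈C log (θ / (δ γ (α - 1/2))) / γ²⌉` with `γ = α - β` and `ratio θ t` for `θ`. -/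
def sampleSize (C θ α β δ : ℝ) (t : ℕ) : ℕ :=
  ⌈C * Real.log (ratio θ t / (δ * (α - β) * (α - 1 / 2))) / (α - β) ^ 2⌉₊

/-! ## The machine model

Randomized random access machines over the natural numbers with unit costs, with access to an
affinity system. A machine has registers, finitely many (named in the program) arrays that are
accessed through registers, and an output to which it writes a list of sets. Arithmetic consists of
addition and truncated subtraction. Control structure is sequential composition, branching and
counted loops, so that every program halts. -/

/-- Programs. `x y z` are names of registers and `a` names of arrays. -/
inductive Prog : Type
  /-- register `x` := the constant `c` -/
  | const (x c : ℕ) : Prog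
  /-- `x := y + z` -/
  | add (x y z : ℕ) : Prog
  /-- `x := y - z`, truncated at `0` -/
  | sub (x y z : ℕ) : Prog
  /-- `x := a[y]` -/
  | load (x a y : ℕ) : Prog
  /-- `a[x] := y` -/
  | store (a x y : ℕ) : Prog
  /-- `x :=` the member that member `y` ranks at position `z` -/
  | query (x y z : ℕ) : Prog
  /-- `x :=` a uniformly random natural number below `y` -/
  | rand (x y : ℕ) : Prog
  /-- begin a new set in the output -/
  | newSet : Prog
  /-- put the content of `x` into the set that was begun last -/
  | emit (x : ℕ) : Prog
  /-- `p`, then `q` -/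
  | seq (p q : Prog) : Prog
  /-- if `x ≤ y` then `p` else `q` -/
  | ite (x y : ℕ) (p q : Prog) : Prog
  /-- repeat `p` as many times as register `x` says when the loop is entered -/
  | loop (x : ℕ) (p : Prog) : Prog

/-- The state of a machine. `seen` holds the members that the machine has come to know: the seed
and the answers to its queries. -/
structure State : Type where
  reg : ℕ → ℕ
  arr : ℕ → ℕ → ℕ
  seen : Finset ℕ
  out : List (Finset ℕ)

/-- Write the number `c` into register `x`. -/
def State.set (s : State) (x c : ℕ) : State := { s with reg := Function.update s.reg x c }

/-- Write the number `c` into the cell `i` of the array `a`. -/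
def State.write (s : State) (a i c : ℕ) : State :=
  { s with arr := Function.update s.arr a (Function.update (s.arr a) i c) }

/-- Ask for the member that `y` ranks at position `z`, and write the answer into register `x`. Only
members that are known already can be asked; if `y` is not known or the position does not exist, the
answer is `0` and nothing becomes known. -/
def State.ask {n : ℕ} (π : Fin n → Equiv.Perm (Fin n)) (s : State) (x y z : ℕ) : State :=
  if h : y ∈ s.seen ∧ y < n ∧ z < n then
    let u : ℕ := (π ⟨y, h.2.1⟩ ⟨z, h.2.2⟩ : Fin n)
    { (s.set x u) with seen := insert u s.seen }
  else s.set x 0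

/-- Put `c` into the output set that was begun last. -/
def State.put (s : State) (c : ℕ) : State :=
  match s.out with
  | [] => { s with out := [{c}] }
  | A :: L => { s with out := insert c A :: L }

/-- A uniformly random natural number below `r` (and `0` if `r = 0`). -/
def randBelow (r : ℕ) : PMF ℕ :=
  if h : (Finset.range r).Nonempty then PMF.uniformOfFinset (Finset.range r) h else PMF.pure 0

/-- `m` runs of `f`, adding the numbers of steps, with one further step for each run. -/
def iterate (f : State → PMF (State × ℕ)) : ℕ → State → PMF (State × ℕ)
  | 0, s => PMF.pure (s, 0)
  | m + 1, s => (f s).bind fun x => (iterate f m x.1).map fun y => (y.1, x.2 + y.2 + 1)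

/-- The joint law of the final state and the number of steps of a program started in a state. Every
elementary instruction and every branching takes one step; a loop takes one step and, for each
repetition, one step more than its body. -/
def exec {n : ℕ} (π : Fin n → Equiv.Perm (Fin n)) : Prog → State → PMF (State × ℕ)
  | .const x c, s => PMF.pure (s.set x c, 1)
  | .add x y z, s => PMF.pure (s.set x (s.reg y + s.reg z), 1)
  | .sub x y z, s => PMF.pure (s.set x (s.reg y - s.reg z), 1)
  | .load x a y, s => PMF.pure (s.set x (s.arr a (s.reg y)), 1)
  | .store a x y, s => PMF.pure
      (s.write a (s.reg x) (s.reg y), 1)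
  | .query x y z, s => PMF.pure (s.ask π x (s.reg y) (s.reg z), 1)
  | .rand x y, s => (randBelow (s.reg y)).map fun c => (s.set x c, 1)
  | .newSet, s => PMF.pure ({ s with out := ∅ :: s.out }, 1)
  | .emit x, s => PMF.pure (s.put (s.reg x), 1)
  | .seq p q, s => (exec π p s).bind fun x =>
      (exec π q x.1).map fun y => (y.1, x.2 + y.2)
  | .ite x y p q, s =>
      (if s.reg x ≤ s.reg y then exec π p s else exec π q s).map fun z => (z.1, z.2 + 1)
  | .loop x p, s => (iterate (exec π p) (s.reg x) s).map fun z => (z.1, z.2 + 1)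

/-- The initial state: registers `0`, `1`, `2` hold the seed `v`, the size `t` and the number `k` of
votes cast by a member; everything else is `0` or empty, and only `v` is known. -/
def initial (v t k : ℕ) : State where
  reg := fun x => if x = 0 then v else if x = 1 then t else if x = 2 then k else 0
  arr := fun _ _ => 0
  seen := {v}
  out := []

/-- A run of the program `P` on an affinity system with `n` members, with seed `v`, target size `t`
and `min ⌈θ t⌉ n` votes per member. -/
def run {n : ℕ} (π : Fin n → Equiv.Perm (Fin n)) (P : Prog) (θ : ℝ) (t : ℕ) (v : Fin n) :
    PMF (State × ℕ) :=
  exec π P (initial v t (min (quota θ t) n))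

end

end Affinity

/-! Good seeds come from double counting. Each member of `S` receives at least `α t` votes from `S`,
so `S` casts at least `α t²` votes inside itself; hence at least `(2 α - 1) t` members cast half of
`t` or more of their votes inside `S`. If `v` is such a member and `u ∈ S`, inclusion-exclusion
gives at least `(α - 1/2) t` members of `S` that `v` votes for and that vote for `u`. Each of them
is a path of probability at least `1 / k²` for the two-step walk (`card_goodSeeds_ge`). As
probabilities sum to at most one, only `O(κ² t / (α - 1/2))` points can pass the threshold
(`card_rough_le`). With sampling, a Chernoff bound and a union bound over `S` replace the exact law
(`prob_hit_le`, `card_hitSet_le`).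

Purification rests on a change of measure (`ev_iid_dominated`). If `S ⊆ S₁` and `|S₁| ≤ B t`, the
uniform law on `S₁` is at least `1 / B` times the uniform law on `S`. So `k₂` draws from `S₁` are at
least `B⁻ᵏ²` times as likely to succeed as `k₂` draws from `S`. Draws from `S` estimate each vote
fraction to within `γ / 2`, up to few expected errors in `S₁`; Markov's inequality leaves fewer than
`γ t / 2` errors with probability at least one half, and then the votes of the approximate set give
`S` exactly (`recover_eq`). About `B` to the power `k₂` repetitions make failure unlikely
(`le_prob_purify`). Averaging over the seed costs the factor `2 α - 1`.

The program needs neither `S₁` nor a test for being a community. In a first round, a constant number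
`m` of walk endpoints vote, and the members with at least `c m` votes form `A`. The walk law is at
least a constant times the uniform law on `S`, so with constant probability `A` differs from `S` in
fewer than `η t` places. In a second round `m l` random members of `A` vote, with `l` of order `log
t`, and the members with at least `c m l` votes are exactly `S` with probability at least one half
(`le_ev_secondRound`). The ambient size `n` must not enter the error bounds. This is achieved by a
tail bound linear in the probability of a vote (`prob_iid_le_countP_le_mul`), since these
probabilities sum to at most `k`. Each attempt costs `O(t log t)` steps and a constant number of
attempts suffices. The machine side is a weakest-precondition calculus for expectations, where a
loop over random choices simulates independent draws (`ev_iid_le_wp_loop`), and a frame rule that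
also bounds the running time (`framed_of_mem_support`). -/

namespace Affinity

open scoped Classical ENNReal

noncomputable section

/-! ## Expectations of nonnegative functions -/

/-- The expectation of `f` under `p`. -/
def ev {Ω : Type*} (p : PMF Ω) (f : Ω → ℝ≥0∞) : ℝ≥0∞ := ∑' a, p a * f a

section ev

variable {Ω Ω' : Type*}

theorem ev_pure (a : Ω) (f : Ω → ℝ≥0∞) : ev (PMF.pure a) f = f a := by
  unfold ev
  rw [tsum_eq_single a]
  · simp
  · intro b hb
    simp [PMF.pure_apply_of_ne _ _ hb]

theorem ev_bind (p : PMF Ω) (q : Ω → PMF Ω') (f : Ω' → ℝ≥0∞) :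
    ev (p.bind q) f = ev p fun a => ev (q a) f := by
  unfold ev
  simp only [PMF.bind_apply, ← ENNReal.tsum_mul_right, ← ENNReal.tsum_mul_left]
  rw [ENNReal.tsum_comm]
  simp only [mul_assoc]

theorem ev_map (p : PMF Ω) (g : Ω → Ω') (f : Ω' → ℝ≥0∞) :
    ev (p.map g) f = ev p fun a => f (g a) := by
  rw [← PMF.bind_pure_comp, ev_bind]
  simp only [Function.comp, ev_pure]

theorem ev_mono_support {p : PMF Ω} {f g : Ω → ℝ≥0∞} (h : ∀ a ∈ p.support, f a ≤ g a) :
    ev p f ≤ ev p g := by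
  refine ENNReal.tsum_le_tsum fun a => ?_
  by_cases ha : a ∈ p.support
  · gcongr
    exact h a ha
  · rw [PMF.mem_support_iff, not_not] at ha
    simp [ha]

theorem ev_mono {p : PMF Ω} {f g : Ω → ℝ≥0∞} (h : ∀ a, f a ≤ g a) : ev p f ≤ ev p g :=
  ev_mono_support fun a _ => h a

theorem ev_const (p : PMF Ω) (c : ℝ≥0∞) : ev p (fun _ => c) = c := by
  unfold ev
  rw [ENNReal.tsum_mul_right, PMF.tsum_coe, one_mul]

theorem ev_add (p : PMF Ω) (f g : Ω → ℝ≥0∞) :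
    ev p (fun a => f a + g a) = ev p f + ev p g := by
  unfold ev
  rw [← ENNReal.tsum_add]
  simp only [mul_add]

theorem ev_const_mul (p : PMF Ω) (c : ℝ≥0∞) (f : Ω → ℝ≥0∞) :
    ev p (fun a => c * f a) = c * ev p f := by
  unfold ev
  rw [← ENNReal.tsum_mul_left]
  simp only [mul_left_comm]

theorem ev_mul_const (p : PMF Ω) (c : ℝ≥0∞) (f : Ω → ℝ≥0∞) :
    ev p (fun a => f a * c) = ev p f * c := by
  simp only [mul_comm _ c, ev_const_mul]

theorem ev_sum {ι : Type*} (p : PMF Ω) (s : Finset ι) (f : ι → Ω → ℝ≥0∞) :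
    ev p (fun a => ∑ i ∈ s, f i a) = ∑ i ∈ s, ev p (f i) := by
  induction s using Finset.induction_on with
  | empty => simp [ev_const]
  | insert i s hi ih => simp only [Finset.sum_insert hi, ev_add, ih]

theorem ev_uniformOfFinset (A : Finset Ω) (h : A.Nonempty) (f : Ω → ℝ≥0∞) :
    ev (PMF.uniformOfFinset A h) f = (A.card : ℝ≥0∞)⁻¹ * ∑ a ∈ A, f a := by
  unfold ev
  rw [tsum_eq_sum (s := A), Finset.mul_sum]
  · refine Finset.sum_congr rfl fun a ha => ?_
    rw [PMF.uniformOfFinset_apply_of_mem _ ha]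
  · intro a ha
    rw [PMF.uniformOfFinset_apply_of_notMem _ ha, zero_mul]

theorem prob_eq_ev (p : PMF Ω) (E : Set Ω) :
    prob p E = ev p fun a => if a ∈ E then 1 else 0 := by
  unfold prob ev
  rw [PMF.toOuterMeasure_apply]
  refine tsum_congr fun a => ?_
  by_cases h : a ∈ E <;> simp [h]

theorem prob_add_prob_compl (p : PMF Ω) (E : Set Ω) : prob p E + prob p Eᶜ = 1 := by
  rw [prob_eq_ev, prob_eq_ev, ← ev_add]
  refine Eq.trans ?_ (ev_const p 1)
  congr 1
  funext a
  by_cases h : a ∈ E <;> simp [h]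

theorem prob_le_one (p : PMF Ω) (E : Set Ω) : prob p E ≤ 1 := by
  rw [← prob_add_prob_compl p E]
  exact le_self_add

theorem one_sub_le_prob {p : PMF Ω} {E : Set Ω} {c : ℝ≥0∞} (h : prob p Eᶜ ≤ c) :
    1 - c ≤ prob p E := by
  rw [← prob_add_prob_compl p E]
  exact tsub_le_iff_right.2 (by gcongr)

theorem prob_compl_le {p : PMF Ω} {E : Set Ω} {c : ℝ≥0∞} (h : c ≤ prob p E) :
    prob p Eᶜ ≤ 1 - c := by
  refine ENNReal.le_sub_of_add_le_right
    (ne_top_of_le_ne_top ENNReal.one_ne_top (h.trans (prob_le_one p E))) ?_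
  rw [← prob_add_prob_compl p E, add_comm]
  gcongr

theorem prob_mono_support {p : PMF Ω} {E F : Set Ω} (h : ∀ a ∈ p.support, a ∈ E → a ∈ F) :
    prob p E ≤ prob p F := by
  rw [prob_eq_ev, prob_eq_ev]
  refine ev_mono_support fun a ha => ?_
  by_cases hE : a ∈ E
  · simp [hE, h a ha hE]
  · simp [hE]

theorem prob_map (p : PMF Ω) (g : Ω → Ω') (E : Set Ω') :
    prob (p.map g) E = prob p (g ⁻¹' E) := by
  simp only [prob_eq_ev, ev_map, Set.mem_preimage]

theorem prob_bind (p : PMF Ω) (q : Ω → PMF Ω') (E : Set Ω') :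
    prob (p.bind q) E = ev p fun a => prob (q a) E := by
  simp only [prob_eq_ev, ev_bind]

theorem mul_prob_le_ev {p : PMF Ω} {E : Set Ω} {f : Ω → ℝ≥0∞} {c : ℝ≥0∞}
    (h : ∀ a ∈ E, c ≤ f a) : c * prob p E ≤ ev p f := by
  rw [prob_eq_ev, ← ev_const_mul]
  refine ev_mono fun a => ?_
  by_cases ha : a ∈ E
  · simpa [ha] using h a ha
  · simp [ha]

theorem prob_biUnion_le {ι : Type*} (p : PMF Ω) (s : Finset ι) (E : Set Ω) (F : ι → Set Ω)
    (h : ∀ a ∈ E, ∃ i ∈ s, a ∈ F i) : prob p E ≤ ∑ i ∈ s, prob p (F i) := by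
  simp only [prob_eq_ev]
  rw [← ev_sum]
  refine ev_mono fun a => ?_
  by_cases ha : a ∈ E
  · obtain ⟨i, hi, hai⟩ := h a ha
    rw [if_pos ha]
    refine le_trans ?_ (Finset.single_le_sum (f := fun i => if a ∈ F i then (1 : ℝ≥0∞) else 0)
      (fun _ _ => bot_le) hi)
    simp [hai]
  · simp [ha]

/-! ### Independent draws -/

theorem length_of_mem_support_iid {p : PMF Ω} {m : ℕ} :
    ∀ {l : List Ω}, l ∈ (iid p m).support → l.length = m := by
  induction m with
  | zero => intro l hl; simp_all [iid]
  | succ m ih =>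
    intro l hl
    simp only [iid, PMF.mem_support_bind_iff, PMF.mem_support_map_iff] at hl
    obtain ⟨a, -, l', hl', rfl⟩ := hl
    simp [ih hl']

theorem ev_iid_succ (p : PMF Ω) (m : ℕ) (f : List Ω → ℝ≥0∞) :
    ev (iid p (m + 1)) f = ev p fun a => ev (iid p m) fun l => f (a :: l) := by
  simp only [iid, ev_bind, ev_map]

/-- Domination of laws passes to independent draws. -/
theorem ev_iid_dominated {p q : PMF Ω} {c : ℝ≥0∞} (h : ∀ a, c * q a ≤ p a) (m : ℕ) :
    ∀ f : List Ω → ℝ≥0∞, c ^ m * ev (iid q m) f ≤ ev (iid p m) f := by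
  have h1 : ∀ f : Ω → ℝ≥0∞, c * ev q f ≤ ev p f := fun f => by
    unfold ev
    rw [← ENNReal.tsum_mul_left]
    refine ENNReal.tsum_le_tsum fun a => ?_
    rw [← mul_assoc]
    gcongr
    exact h a
  induction m with
  | zero => intro f; simp [iid, ev_pure]
  | succ m ih =>
    intro f
    rw [ev_iid_succ, ev_iid_succ, pow_succ, mul_comm (c ^ m), mul_assoc, ← ev_const_mul]
    refine (h1 _).trans (ev_mono fun a => ih _)

theorem ev_iid_pow_countP (p : PMF Ω) (D : Ω → Bool) (y : ℝ≥0∞) (m : ℕ) :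
    ev (iid p m) (fun l => y ^ l.countP D) = ev p (fun a => if D a then y else 1) ^ m := by
  induction m with
  | zero => simp [iid, ev_pure]
  | succ m ih =>
    rw [ev_iid_succ, pow_succ', ← ih, ← ev_mul_const]
    congr 1
    funext a
    rw [← ev_const_mul]
    congr 1
    funext l
    by_cases h : D a <;> simp [h, pow_succ']

/-- This is `y` times the derivative in `y` of the generating function in `ev_iid_pow_countP`. The
exact exponent would be `m - 1`; since the base is at least one, `m` is also valid and keeps the
induction uniform. -/
theorem ev_iid_countP_mul_pow_countP_le (p : PMF Ω) (D : Ω → Bool) {y : ℝ≥0∞} (hy : 1 ≤ y)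
    (m : ℕ) :
    ev (iid p m) (fun l => l.countP D * y ^ l.countP D) ≤
      m * ev p (fun a => if D a then y else 0) * ev p (fun a => if D a then y else 1) ^ m := by
  set A := ev p (fun a => if D a then y else 1) with hA
  set B := ev p (fun a => if D a then y else 0) with hB
  have h1A : 1 ≤ A := by
    rw [← ev_const p 1]
    exact ev_mono fun a => by by_cases h : D a <;> simp [h, hy]
  induction m with
  | zero => simp [iid, ev_pure]
  | succ m ih =>
    have key : ev (iid p (m + 1)) (fun l => (l.countP D : ℝ≥0∞) * y ^ l.countP D) =
        A * ev (iid p m) (fun l => l.countP D * y ^ l.countP D) + B * A ^ m := by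
      rw [ev_iid_succ, ← ev_iid_pow_countP, hA, hB, ← ev_mul_const, ← ev_mul_const, ← ev_add]
      congr 1
      funext a
      rw [← ev_const_mul, ← ev_const_mul, ← ev_add]
      congr 1
      funext l
      by_cases h : D a
      · simp only [h, List.countP_cons_of_pos, if_true]
        push_cast
        ring
      · simp [h]
    rw [key]
    calc _ ≤ A * (m * B * A ^ m) + B * A ^ m * A := by
          exact add_le_add (by gcongr) (le_mul_of_one_le_right bot_le h1A)
      _ = _ := by
          push_cast
          ring

end ev

/-! ## Tail bounds for the number of occurrences of an event -/

section tails

variable {Ω : Type*}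

theorem prob_eq_ofReal_toReal (p : PMF Ω) (E : Set Ω) :
    prob p E = ENNReal.ofReal (prob p E).toReal :=
  (ENNReal.ofReal_toReal (ne_top_of_le_ne_top ENNReal.one_ne_top (prob_le_one p E))).symm

theorem prob_compl_eq_ofReal (p : PMF Ω) (E : Set Ω) :
    prob p Eᶜ = ENNReal.ofReal (1 - (prob p E).toReal) := by
  have h := prob_add_prob_compl p E
  rw [ENNReal.ofReal_sub _ ENNReal.toReal_nonneg, ← prob_eq_ofReal_toReal, ENNReal.ofReal_one, ← h]
  rw [ENNReal.add_sub_cancel_left (ne_top_of_le_ne_top ENNReal.one_ne_top (prob_le_one p E))]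

theorem toReal_prob_le_one (p : PMF Ω) (E : Set Ω) : (prob p E).toReal ≤ 1 := by
  simpa using ENNReal.toReal_mono ENNReal.one_ne_top (prob_le_one p E)

theorem ev_ite (p : PMF Ω) (D : Ω → Bool) (x y : ℝ≥0∞) :
    ev p (fun a => if D a then x else y) =
      prob p {a | D a} * x + prob p {a | D a}ᶜ * y := by
  rw [prob_eq_ev, prob_eq_ev, ← ev_mul_const, ← ev_mul_const, ← ev_add]
  congr 1
  funext a
  by_cases h : D a <;> simp [h]

/-- For `|s| ≤ 1`, `eˢ ≤ 1 + s + s²`, and `1 + x ≤ eˣ` finishes. Comparing the probability with `b`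
only after multiplication by `s` serves both tails: an upper bound for positive `s`, a lower bound
for negative `s`. -/
theorem ev_ite_exp_le (p : PMF Ω) (D : Ω → Bool) {s b : ℝ} (hs : |s| ≤ 1)
    (hb : s * (prob p {a | D a}).toReal ≤ s * b) :
    ev p (fun a => if D a then ENNReal.ofReal (Real.exp s) else 1) ≤
      ENNReal.ofReal (Real.exp (s * b + s ^ 2)) := by
  rw [ev_ite, prob_compl_eq_ofReal, prob_eq_ofReal_toReal p {a | D a}]
  have h1 := toReal_prob_le_one p {a | D a}
  have h0 : 0 ≤ (prob p {a | D a}).toReal := ENNReal.toReal_nonneg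
  rw [ENNReal.toReal_ofReal h0]
  set μ := (prob p {a | D a}).toReal
  rw [mul_one, ← ENNReal.ofReal_mul h0, ← ENNReal.ofReal_add (by positivity) (by linarith)]
  refine ENNReal.ofReal_le_ofReal ?_
  have h2 := (abs_le.1 (Real.abs_exp_sub_one_sub_id_le hs)).2
  have h3 := Real.add_one_le_exp (s * b + s ^ 2)
  have h4 : μ * (Real.exp s - 1 - s) ≤ s ^ 2 :=
    (mul_le_mul_of_nonneg_left h2 h0).trans (mul_le_of_le_one_left (sq_nonneg s) h1)
  nlinarith

theorem ev_iid_exp_countP_le (p : PMF Ω) (D : Ω → Bool) {s b : ℝ} (hs : |s| ≤ 1)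
    (hb : s * (prob p {a | D a}).toReal ≤ s * b) (m : ℕ) :
    ev (iid p m) (fun l => ENNReal.ofReal (Real.exp s) ^ l.countP D) ≤
      ENNReal.ofReal (Real.exp (m * (s * b + s ^ 2))) := by
  rw [ev_iid_pow_countP, Real.exp_nat_mul, ENNReal.ofReal_pow (Real.exp_pos _).le]
  gcongr
  exact ev_ite_exp_le p D hs hb

theorem le_ofReal_div_of_mul_le {c y : ℝ} {q : ℝ≥0∞} (hc : 0 < c)
    (h : ENNReal.ofReal c * q ≤ ENNReal.ofReal y) : q ≤ ENNReal.ofReal (y / c) := by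
  rw [ENNReal.ofReal_div_of_pos hc]
  rw [ENNReal.le_div_iff_mul_le (Or.inl (by simpa using hc)) (Or.inl ENNReal.ofReal_ne_top),
    mul_comm]
  exact h

theorem ofReal_exp_pow (s : ℝ) (j : ℕ) :
    ENNReal.ofReal (Real.exp s) ^ j = ENNReal.ofReal (Real.exp (s * j)) := by
  rw [← ENNReal.ofReal_pow (Real.exp_pos _).le, ← Real.exp_nat_mul, mul_comm]

/-- Few occurrences of an event of probability at least `a`. -/
theorem prob_iid_countP_lt_le (p : PMF Ω) (D : Ω → Bool) {a η x : ℝ} {m : ℕ} (hη : 0 ≤ η)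
    (hη1 : η ≤ 1) (ha : a ≤ (prob p {a | D a}).toReal) (hx : x ≤ (a - η) * m) :
    prob (iid p m) {l | (l.countP D : ℝ) < x} ≤ ENNReal.ofReal (Real.exp (-(m * η ^ 2 / 4))) := by
  -- Exponential Markov inequality with `s = -η/2`, which minimizes `s² + s η` and gives the
  -- exponent `-η²/4` per draw.
  have h := (mul_prob_le_ev (p := iid p m) (E := {l | (l.countP D : ℝ) < x})
    (f := fun l => ENNReal.ofReal (Real.exp (-(η / 2))) ^ l.countP D)
    (c := ENNReal.ofReal (Real.exp (-(η / 2) * x))) ?_).trans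
    (ev_iid_exp_countP_le p D (b := a) ?_ ?_ m)
  · refine (le_ofReal_div_of_mul_le (Real.exp_pos _) h).trans (ENNReal.ofReal_le_ofReal ?_)
    rw [← Real.exp_sub, Real.exp_le_exp]
    nlinarith
  · intro l hl
    rw [ofReal_exp_pow]
    refine ENNReal.ofReal_le_ofReal (Real.exp_le_exp.2 ?_)
    have : (l.countP D : ℝ) < x := hl
    nlinarith
  · rw [abs_le]
    constructor <;> linarith
  · nlinarith

/-- Many occurrences of an event of probability at most `b`. -/
theorem prob_iid_le_countP_le (p : PMF Ω) (D : Ω → Bool) {b η x : ℝ} {m : ℕ} (hη : 0 ≤ η)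
    (hη1 : η ≤ 1) (hb : (prob p {a | D a}).toReal ≤ b) (hx : (b + η) * m ≤ x) :
    prob (iid p m) {l | x ≤ (l.countP D : ℝ)} ≤ ENNReal.ofReal (Real.exp (-(m * η ^ 2 / 4))) := by
  have h := (mul_prob_le_ev (p := iid p m) (E := {l | x ≤ (l.countP D : ℝ)})
    (f := fun l => ENNReal.ofReal (Real.exp (η / 2)) ^ l.countP D)
    (c := ENNReal.ofReal (Real.exp (η / 2 * x))) ?_).trans
    (ev_iid_exp_countP_le p D (b := b) ?_ ?_ m)
  · refine (le_ofReal_div_of_mul_le (Real.exp_pos _) h).trans (ENNReal.ofReal_le_ofReal ?_)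
    rw [← Real.exp_sub, Real.exp_le_exp]
    nlinarith
  · intro l hl
    rw [ofReal_exp_pow]
    refine ENNReal.ofReal_le_ofReal (Real.exp_le_exp.2 ?_)
    have : x ≤ (l.countP D : ℝ) := hl
    nlinarith
  · rw [abs_le]
    constructor <;> linarith
  · nlinarith

/-- Many occurrences of an event of probability at most `b`: a bound that is linear in the
probability. -/
theorem prob_iid_le_countP_le_mul (p : PMF Ω) (D : Ω → Bool) {b η x : ℝ} {m : ℕ} (hη : 0 < η)
    (hη1 : η ≤ 1) (hb0 : 0 ≤ b) (hb : (prob p {a | D a}).toReal ≤ b) (hm : 0 < m)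
    (hx : (b + η) * m ≤ x) :
    prob (iid p m) {l | x ≤ (l.countP D : ℝ)} ≤
      prob p {a | D a} * ENNReal.ofReal (2 / η * Real.exp (-(m * η ^ 2 / 4))) := by
  have hm' : (0 : ℝ) < m := by exact_mod_cast hm
  have hs1 : (1 : ℝ≥0∞) ≤ ENNReal.ofReal (Real.exp (η / 2)) := by
    rw [← ENNReal.ofReal_one]
    exact ENNReal.ofReal_le_ofReal (Real.one_le_exp (by positivity))
  -- Markov's inequality for `X e^{sX}` in place of `e^{sX}`. The extra `X` puts the factor `m`
  -- times the probability of the event into the expectation, and on the tail `X ≥ η m`, so that `m`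
  -- cancels.
  have h := (mul_prob_le_ev (p := iid p m) (E := {l | x ≤ (l.countP D : ℝ)})
    (f := fun l => l.countP D * ENNReal.ofReal (Real.exp (η / 2)) ^ l.countP D)
    (c := ENNReal.ofReal (η * m * Real.exp (η / 2 * x))) ?_).trans
    (ev_iid_countP_mul_pow_countP_le p D hs1 m)
  · have h2 : ev p (fun a => if D a then ENNReal.ofReal (Real.exp (η / 2)) else 1) ^ m ≤
        ENNReal.ofReal (Real.exp (m * (η / 2 * b + (η / 2) ^ 2))) := by
      rw [← ev_iid_pow_countP]
      refine ev_iid_exp_countP_le p D ?_ ?_ m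
      · rw [abs_le]
        constructor <;> linarith
      · nlinarith
    have h3 : ev p (fun a => if D a then ENNReal.ofReal (Real.exp (η / 2)) else 0) ≤
        prob p {a | D a} * 2 := by
      rw [ev_ite, mul_zero, add_zero]
      gcongr
      rw [← ENNReal.ofReal_ofNat]
      refine ENNReal.ofReal_le_ofReal ?_
      have := (abs_le.1 (Real.abs_exp_sub_one_sub_id_le (x := η / 2)
        (by rw [abs_le]; constructor <;> linarith))).2
      nlinarith
    have h4 := h.trans (mul_le_mul' (mul_le_mul_right h3 _) h2)
    rw [prob_eq_ofReal_toReal p {a | D a}] at h4 ⊢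
    set μ := (prob p {a | D a}).toReal
    have hμ : 0 ≤ μ := ENNReal.toReal_nonneg
    rw [← ENNReal.ofReal_ofNat 2, ← ENNReal.ofReal_mul hμ, ← ENNReal.ofReal_natCast m,
      ← ENNReal.ofReal_mul hm'.le, ← ENNReal.ofReal_mul (by positivity)] at h4
    rw [← ENNReal.ofReal_mul hμ]
    refine (le_ofReal_div_of_mul_le (by positivity) h4).trans (ENNReal.ofReal_le_ofReal ?_)
    have h5 : Real.exp (m * (η / 2 * b + (η / 2) ^ 2)) ≤
        Real.exp (-(m * η ^ 2 / 4)) * Real.exp (η / 2 * x) := by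
      rw [← Real.exp_add, Real.exp_le_exp]
      nlinarith
    rw [div_le_iff₀ (by positivity)]
    calc _ ≤ m * (μ * 2) * (Real.exp (-(m * η ^ 2 / 4)) * Real.exp (η / 2 * x)) := by gcongr
      _ = _ := by
        field_simp
  · intro l hl
    have hl' : x ≤ (l.countP D : ℝ) := hl
    rw [ofReal_exp_pow, ← ENNReal.ofReal_natCast, ← ENNReal.ofReal_mul (Nat.cast_nonneg _)]
    refine ENNReal.ofReal_le_ofReal ?_
    have h6 : η * m ≤ (l.countP D : ℝ) := by nlinarith
    gcongr

end tails

/-! ## Votes -/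

section votes

variable {n : ℕ} {π : Fin n → Equiv.Perm (Fin n)}

theorem mem_top {k : ℕ} {i j : Fin n} : j ∈ top π k i ↔ ((π i).symm j : ℕ) < k := by
  simp [top]

theorem card_top (π : Fin n → Equiv.Perm (Fin n)) (k : ℕ) (i : Fin n) :
    (top π k i).card = min n k := by
  rw [← Fin.card_filter_val_lt]
  exact Finset.card_equiv (π i).symm fun j => by simp [mem_top]

theorem card_top_le (π : Fin n → Equiv.Perm (Fin n)) (k : ℕ) (i : Fin n) :
    (top π k i).card ≤ k := by
  rw [card_top]
  exact min_le_right _ _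

theorem top_min (π : Fin n → Equiv.Perm (Fin n)) (k : ℕ) (i : Fin n) :
    top π (min k n) i = top π k i := by
  ext j
  simp [mem_top]

theorem top_nonempty {k : ℕ} (hk : 0 < k) (i : Fin n) : (top π k i).Nonempty := by
  rw [← Finset.card_pos, card_top]
  exact lt_min i.pos hk

theorem quota_pos {θ : ℝ} (hθ : 0 < θ) {t : ℕ} (ht : 0 < t) : 0 < quota θ t := by
  unfold quota
  rw [Nat.ceil_pos]
  positivity

theorem ratio_pos {θ : ℝ} (hθ : 0 < θ) {t : ℕ} (ht : 0 < t) : 0 < ratio θ t := by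
  have := quota_pos hθ ht
  unfold ratio
  positivity

theorem sum_votes (π : Fin n → Equiv.Perm (Fin n)) (k : ℕ) (A X : Finset (Fin n)) :
    ∑ i ∈ X, votes π k A i = ∑ s ∈ A, (X.filter fun i => i ∈ top π k s).card := by
  simp only [votes, Finset.card_filter]
  exact Finset.sum_comm

theorem sum_votes_le (π : Fin n → Equiv.Perm (Fin n)) (k : ℕ) (A X : Finset (Fin n)) :
    ∑ i ∈ X, votes π k A i ≤ A.card * k := by
  rw [sum_votes]
  refine (Finset.sum_le_card_nsmul _ _ k fun s _ => ?_).trans (by simp)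
  exact (Finset.card_le_card fun i hi => (Finset.mem_filter.1 hi).2).trans (card_top_le π k s)

theorem votes_le_votes_add (π : Fin n → Equiv.Perm (Fin n)) (k : ℕ) (A B : Finset (Fin n))
    (i : Fin n) : votes π k A i ≤ votes π k B i + (A \ B).card := by
  refine le_trans (Finset.card_le_card ?_) (Finset.card_union_le _ _)
  intro s hs
  rw [Finset.mem_filter] at hs
  by_cases hB : s ∈ B
  · exact Finset.mem_union_left _ (Finset.mem_filter.2 ⟨hB, hs.2⟩)
  · exact Finset.mem_union_right _ (Finset.mem_sdiff.2 ⟨hs.1, hB⟩)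

theorem card_symmDiff' (A B : Finset (Fin n)) :
    (symmDiff A B).card = (A \ B).card + (B \ A).card := by
  rw [Finset.symmDiff_def]
  exact Finset.card_union_of_disjoint disjoint_sdiff_sdiff

theorem card_add_card_sdiff (A B : Finset (Fin n)) :
    A.card + (B \ A).card = B.card + (A \ B).card := by
  have h1 := Finset.card_sdiff_add_card_inter A B
  have h2 := Finset.card_sdiff_add_card_inter B A
  rw [Finset.inter_comm] at h2
  omega

/-- Members of `S` receive at least `α t²` votes from `S`, which casts at most `k t`. This bounds
`κ` from below, so that the sample sizes do not degenerate. -/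
theorem le_ratio {θ α β : ℝ} {S : Finset (Fin n)} (hS : S.Nonempty)
    (h : IsCommunity π θ α β S) : α ≤ ratio θ S.card := by
  have h0 : (0 : ℝ) < S.card := by exact_mod_cast hS.card_pos
  have h1 : S.card * (α * S.card) ≤ ∑ i ∈ S, (votes π (quota θ S.card) S i : ℝ) := by
    rw [← nsmul_eq_mul]
    exact Finset.card_nsmul_le_sum _ _ _ h.inside
  have h2 : ∑ i ∈ S, (votes π (quota θ S.card) S i : ℝ) ≤ S.card * quota θ S.card := by
    exact_mod_cast sum_votes_le π (quota θ S.card) S S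
  unfold ratio
  rw [le_div_iff₀ h0]
  exact le_of_mul_le_mul_left (h1.trans h2) h0

/-! ### Good seeds -/

theorem vote_eq {k : ℕ} (hk : 0 < k) (v : Fin n) :
    vote π k v = PMF.uniformOfFinset (top π k v) (top_nonempty hk v) := by
  simp [vote, top_nonempty hk v]

theorem inv_le_vote_apply {k : ℕ} (hk : 0 < k) {v w : Fin n} (h : w ∈ top π k v) :
    (k : ℝ≥0∞)⁻¹ ≤ vote π k v w := by
  rw [vote_eq hk, PMF.uniformOfFinset_apply_of_mem _ h, ENNReal.inv_le_inv]
  exact_mod_cast card_top_le π k v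

/-- Each intermediate `w` contributes two steps of probability at least `1 / k`; the list of a
member has at most `k` entries, and fewer if `k > n`. -/
theorem le_walk_apply {k : ℕ} (hk : 0 < k) (S : Finset (Fin n)) (v u : Fin n) :
    ((S.filter fun w => w ∈ top π k v ∧ u ∈ top π k w).card : ℝ) / k ^ 2 ≤
      (walk π k v u).toReal := by
  have h : ((S.filter fun w => w ∈ top π k v ∧ u ∈ top π k w).card : ℝ≥0∞) *
      ((k : ℝ≥0∞)⁻¹ * (k : ℝ≥0∞)⁻¹) ≤ walk π k v u := by
    unfold walk
    rw [PMF.bind_apply, ← nsmul_eq_mul]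
    refine le_trans ?_ (ENNReal.sum_le_tsum (S.filter fun w => w ∈ top π k v ∧ u ∈ top π k w))
    refine Finset.card_nsmul_le_sum _ _ _ fun w hw => ?_
    rw [Finset.mem_filter] at hw
    exact mul_le_mul' (inv_le_vote_apply hk hw.2.1) (inv_le_vote_apply hk hw.2.2)
  have h2 := ENNReal.toReal_mono (PMF.apply_ne_top _ _) h
  simp only [ENNReal.toReal_mul, ENNReal.toReal_inv, ENNReal.toReal_natCast] at h2
  refine le_trans (le_of_eq ?_) h2
  rw [div_eq_mul_inv, sq, mul_inv]

theorem threshold_mul {θ α : ℝ} (hθ : 0 < θ) (hα : 1 / 2 < α) {t : ℕ} (ht : 0 < t) :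
    threshold θ α t * (ratio θ t ^ 2 * t / (α - 1 / 2)) = 1 := by
  have h1 := ratio_pos hθ ht
  have h2 : 0 < α - 1 / 2 := by linarith
  have h3 : (0 : ℝ) < t := by exact_mod_cast ht
  unfold threshold
  generalize α - 1 / 2 = a at h2
  field_simp

theorem threshold_pos {θ α : ℝ} (hθ : 0 < θ) (hα : 1 / 2 < α) {t : ℕ} (ht : 0 < t) :
    0 < threshold θ α t := by
  have h1 := ratio_pos hθ ht
  have h2 : 0 < α - 1 / 2 := by linarith
  unfold threshold
  positivity

theorem threshold_eq {θ α : ℝ} {t : ℕ} (ht : 0 < t) :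
    threshold θ α t = (α - 1 / 2) * t / (quota θ t : ℝ) ^ 2 := by
  have h3 : (0 : ℝ) < t := by exact_mod_cast ht
  unfold threshold ratio
  field_simp

/-- Inside `S`, the at least `t / 2` members chosen by `v` and the at least `α t` members voting for
`u` overlap in at least `(α - 1/2) t` members. -/
theorem mem_goodSeeds_of_half {θ α β : ℝ} (hθ : 0 < θ) {S : Finset (Fin n)}
    (hS : S.Nonempty) (h : IsCommunity π θ α β S) {v : Fin n} (hv : v ∈ S)
    (hv2 : (S.card : ℝ) / 2 ≤ ((S.filter fun i => i ∈ top π (quota θ S.card) v).card : ℝ)) :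
    v ∈ goodSeeds π θ α S := by
  refine Finset.mem_filter.2 ⟨hv, fun u hu => ?_⟩
  refine le_trans ?_ (le_walk_apply (quota_pos hθ hS.card_pos) S v u)
  rw [threshold_eq hS.card_pos]
  gcongr
  have h1 := h.inside u hu
  have h2 := Finset.card_union_add_card_inter (S.filter fun i => i ∈ top π (quota θ S.card) v)
    (S.filter fun s => u ∈ top π (quota θ S.card) s)
  rw [← Finset.filter_and] at h2
  have h3 := Finset.card_le_card (Finset.union_subset
    (Finset.filter_subset (fun i => i ∈ top π (quota θ S.card) v) S)
    (Finset.filter_subset (fun s => u ∈ top π (quota θ S.card) s) S))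
  unfold votes at h1
  have h2' : (_ : ℝ) = _ := congrArg (Nat.cast : ℕ → ℝ) h2
  push_cast at h2'
  have h3' : (_ : ℝ) ≤ _ := (Nat.cast_le (α := ℝ)).2 h3
  linarith

/-- A member that is not a good seed casts fewer than `t / 2` votes inside `S`, a good seed at most
`t`. With `g` good seeds the at least `α t²` internal votes force `α t² ≤ t²/2 + g t/2`. -/
theorem card_goodSeeds_ge {θ α β : ℝ} (hθ : 0 < θ) {S : Finset (Fin n)}
    (hS : S.Nonempty) (h : IsCommunity π θ α β S) :
    (2 * α - 1) * (S.card : ℝ) ≤ ((goodSeeds π θ α S).card : ℝ) := by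
  have ht : (0 : ℝ) < S.card := by exact_mod_cast hS.card_pos
  set k := quota θ S.card with hk
  have h1 : S.card * (α * S.card) ≤ ∑ i ∈ S, (votes π k S i : ℝ) := by
    rw [← nsmul_eq_mul]
    exact Finset.card_nsmul_le_sum _ _ _ h.inside
  have h2 : ∑ i ∈ S, (votes π k S i : ℝ) =
      ∑ s ∈ S, ((S.filter fun i => i ∈ top π k s).card : ℝ) := by
    exact_mod_cast sum_votes π k S S
  have h3 : ∀ s ∈ S, ((S.filter fun i => i ∈ top π k s).card : ℝ) ≤
      S.card / 2 + if s ∈ goodSeeds π θ α S then (S.card : ℝ) / 2 else 0 := by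
    intro s hs
    split_ifs with hg
    · have : ((S.filter fun i => i ∈ top π k s).card : ℝ) ≤ S.card := by
        exact_mod_cast Finset.card_le_card (Finset.filter_subset _ S)
      linarith
    · by_contra hlt
      exact hg (mem_goodSeeds_of_half hθ hS h hs (by linarith))
  have h4 := Finset.sum_le_sum h3
  rw [Finset.sum_add_distrib, Finset.sum_const, ← Finset.sum_filter, Finset.sum_const,
    nsmul_eq_mul, nsmul_eq_mul] at h4
  have h5 : ((S.filter fun s => s ∈ goodSeeds π θ α S).card : ℝ) ≤ (goodSeeds π θ α S).card := by
    exact_mod_cast Finset.card_le_card fun i hi => (Finset.mem_filter.1 hi).2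
  have h6 : ((S.filter fun s => s ∈ goodSeeds π θ α S).card : ℝ) * (S.card / 2) ≤
      (goodSeeds π θ α S).card * (S.card / 2) := by gcongr
  have h7 : (2 * α - 1) * (S.card : ℝ) * (S.card / 2) ≤
      (goodSeeds π θ α S).card * (S.card / 2) := by
    rw [h2] at h1
    nlinarith
  exact le_of_mul_le_mul_right h7 (by positivity)

theorem subset_rough {θ α : ℝ} {S : Finset (Fin n)} {v : Fin n} (hv : v ∈ goodSeeds π θ α S) :
    S ⊆ rough π θ α S.card v := fun u hu =>
  Finset.mem_filter.2 ⟨Finset.mem_univ u, (Finset.mem_filter.1 hv).2 u hu⟩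

theorem card_rough_le {θ α : ℝ} (hθ : 0 < θ) (hα : 1 / 2 < α) {t : ℕ} (ht : 0 < t) (v : Fin n) :
    ((rough π θ α t v).card : ℝ) ≤ ratio θ t ^ 2 * t / (α - 1 / 2) := by
  have h0 := threshold_pos hθ hα ht
  have h1 : (rough π θ α t v).card * threshold θ α t ≤ 1 := by
    rw [← nsmul_eq_mul]
    refine (Finset.card_nsmul_le_sum _ (fun u => (walk π (quota θ t) v u).toReal) _
      fun u hu => (Finset.mem_filter.1 hu).2).trans ?_
    rw [← ENNReal.toReal_sum fun u _ => PMF.apply_ne_top _ _]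
    refine ENNReal.toReal_mono ENNReal.one_ne_top ?_ |>.trans_eq ENNReal.toReal_one
    exact (ENNReal.sum_le_tsum _).trans_eq (PMF.tsum_coe _)
  refine le_of_mul_le_mul_right ?_ h0
  rw [mul_comm _ (threshold θ α t), mul_comm _ (threshold θ α t), threshold_mul hθ hα ht, mul_comm]
  exact h1

/-! ### Votes of an approximation of a community -/

theorem recover_eq {θ α β : ℝ} (hβ : 0 ≤ β) (hαβ : β < α) (hα1 : α ≤ 1)
    {S S₂ : Finset (Fin n)} (h : IsCommunity π θ α β S)
    (hS₂ : ((symmDiff S S₂).card : ℝ) < (α - β) / 2 * S.card) :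
    recover π θ α β S.card S₂ = S := by
  rw [card_symmDiff'] at hS₂
  push_cast at hS₂
  have hc : (_ : ℝ) = _ := congrArg (Nat.cast : ℕ → ℝ) (card_add_card_sdiff S S₂)
  push_cast at hc
  have ha : (0 : ℝ) ≤ (S \ S₂).card := Nat.cast_nonneg _
  have hb : (0 : ℝ) ≤ (S₂ \ S).card := Nat.cast_nonneg _
  ext i
  simp only [recover, Finset.mem_filter, Finset.mem_univ, true_and]
  constructor
  · intro hi
    by_contra hiS
    have h1 := h.outside i hiS
    have h2 : (_ : ℝ) ≤ _ :=
      (Nat.cast_le (α := ℝ)).2 (votes_le_votes_add π (quota θ S.card) S₂ S i)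
    push_cast at h2
    nlinarith
  · intro hiS
    have h1 := h.inside i hiS
    have h2 : (_ : ℝ) ≤ _ :=
      (Nat.cast_le (α := ℝ)).2 (votes_le_votes_add π (quota θ S.card) S S₂ i)
    push_cast at h2
    nlinarith

end votes

/-! ## Purification -/

section purification

variable {n : ℕ} {π : Fin n → Equiv.Perm (Fin n)}

/-- Markov's inequality for the number of errors of a random set. -/
theorem prob_card_symmDiff_le {Ω : Type*} (p : PMF Ω) (X Y : Finset (Fin n))
    (T : Ω → Finset (Fin n)) (hT : ∀ a ∈ p.support, symmDiff X (T a) ⊆ Y) {e : ℝ} (he : 0 < e)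
    (c : ℝ≥0∞) (hc : ∑ i ∈ Y, prob p {a | i ∈ symmDiff X (T a)} ≤ c) :
    prob p {a | e ≤ (symmDiff X (T a)).card} ≤ c / ENNReal.ofReal e := by
  have h1 : ev p (fun a => ((symmDiff X (T a)).card : ℝ≥0∞)) ≤ c := by
    refine le_trans ?_ hc
    simp only [prob_eq_ev]
    rw [← ev_sum]
    refine ev_mono_support fun a ha => ?_
    refine le_trans ?_ (Finset.sum_le_sum_of_subset (hT a ha))
    rw [← nsmul_one]
    refine Finset.card_nsmul_le_sum _ _ _ fun i hi => ?_
    rw [if_pos (show a ∈ {a | i ∈ symmDiff X (T a)} from hi)]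
  rw [ENNReal.le_div_iff_mul_le (Or.inl (by simpa using he)) (Or.inl ENNReal.ofReal_ne_top),
    mul_comm]
  refine (mul_prob_le_ev (fun a ha => ?_)).trans h1
  rw [← ENNReal.ofReal_natCast]
  exact ENNReal.ofReal_le_ofReal ha

theorem toReal_prob_uniform_vote (k : ℕ) (A : Finset (Fin n)) (hA : A.Nonempty) (i : Fin n) :
    (prob (PMF.uniformOfFinset A hA) {s | decide (i ∈ top π k s) = true}).toReal =
      votes π k A i / A.card := by
  rw [prob_eq_ev, ev_uniformOfFinset]
  simp only [Set.mem_ofPred_eq, decide_eq_true_eq]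
  rw [← Finset.sum_filter, Finset.sum_const, nsmul_eq_mul, mul_one, ENNReal.toReal_mul,
    ENNReal.toReal_inv, ENNReal.toReal_natCast, ENNReal.toReal_natCast, votes, div_eq_inv_mul]

theorem mem_refine {θ α β : ℝ} {t : ℕ} {S₁ : Finset (Fin n)} {U : List (Fin n)} {i : Fin n} :
    i ∈ refine π θ α β t S₁ U ↔ i ∈ S₁ ∧ (α - (α - β) / 2) * U.length ≤
      (U.countP fun u => decide (i ∈ top π (quota θ t) u) : ℝ) := by
  unfold refine
  rw [Finset.mem_filter]

/-- The draws here come from `S` itself, where vote frequencies are vote counts divided by `t`. The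
threshold is halfway between `α` and `β`, so the deviation is `γ/2` and the exponent `(γ/2)²/4`. -/
theorem prob_mem_symmDiff_refine_le {θ α β : ℝ} (hβ : 0 ≤ β) (hαβ : β < α) (hα1 : α ≤ 1)
    {S : Finset (Fin n)} (hS : S.Nonempty) (h : IsCommunity π θ α β S) {S₁ : Finset (Fin n)}
    (k₂ : ℕ) {i : Fin n} (hi : i ∈ S₁) :
    prob (iid (PMF.uniformOfFinset S hS) k₂)
        {U | i ∈ symmDiff S (refine π θ α β S.card S₁ U)} ≤
      ENNReal.ofReal (Real.exp (-(k₂ * (α - β) ^ 2 / 16))) := by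
  have ht : (0 : ℝ) < S.card := by exact_mod_cast hS.card_pos
  have hη : (0 : ℝ) ≤ (α - β) / 2 := by linarith
  have hη1 : (α - β) / 2 ≤ 1 := by linarith
  have hexp : (k₂ * (α - β) ^ 2 / 16 : ℝ) = k₂ * ((α - β) / 2) ^ 2 / 4 := by ring
  rw [hexp]
  by_cases hiS : i ∈ S
  · refine le_trans (prob_mono_support fun U hU hmem => ?_)
      (prob_iid_countP_lt_le (PMF.uniformOfFinset S hS)
        (fun u => decide (i ∈ top π (quota θ S.card) u)) (a := α) hη hη1 ?_ le_rfl)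
    · simp only [Set.mem_ofPred_eq, Finset.mem_symmDiff, hiS, mem_refine, hi, true_and,
        not_true_eq_false, and_false, or_false, not_le, length_of_mem_support_iid hU] at hmem ⊢
      exact hmem
    · rw [toReal_prob_uniform_vote, le_div_iff₀ ht]
      exact h.inside i hiS
  · refine le_trans (prob_mono_support fun U hU hmem => ?_)
      (prob_iid_le_countP_le (PMF.uniformOfFinset S hS)
        (fun u => decide (i ∈ top π (quota θ S.card) u)) (b := β) hη hη1 ?_ le_rfl)
    · simp only [Set.mem_ofPred_eq, Finset.mem_symmDiff, hiS, mem_refine, hi, true_and,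
        false_and, not_false_eq_true, and_true, false_or, length_of_mem_support_iid hU] at hmem ⊢
      refine le_of_eq_of_le ?_ hmem
      ring
    · rw [toReal_prob_uniform_vote, div_le_iff₀ ht]
      exact h.outside i hiS

theorem prob_iid_forall {Ω : Type*} (p : PMF Ω) (E : Set Ω) (N : ℕ) :
    prob (iid p N) {l | ∀ a ∈ l, a ∈ E} = prob p E ^ N := by
  induction N with
  | zero => simp [iid, prob_eq_ev, ev_pure]
  | succ N ih =>
    rw [pow_succ', ← ih, prob_eq_ev, ev_iid_succ, prob_eq_ev p, ← ev_mul_const]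
    congr 1
    funext a
    rw [prob_eq_ev, ← ev_const_mul]
    congr 1
    funext l
    by_cases h : a ∈ E <;> simp [h]

theorem pow_one_sub_le {q η : ℝ} {N : ℕ} (hq : 0 ≤ q) (hη : 0 < η)
    (hN : Real.log (1 / η) ≤ q * N) :
    (1 - ENNReal.ofReal q) ^ N ≤ ENNReal.ofReal η := by
  have h1 : 1 - ENNReal.ofReal q ≤ ENNReal.ofReal (Real.exp (-q)) := by
    rw [← ENNReal.ofReal_one, ← ENNReal.ofReal_sub _ hq]
    exact ENNReal.ofReal_le_ofReal (Real.one_sub_le_exp_neg q)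
  refine (pow_le_pow_left' h1 N).trans ?_
  rw [ofReal_exp_pow]
  refine ENNReal.ofReal_le_ofReal ?_
  rw [← Real.exp_log hη, Real.exp_le_exp]
  rw [one_div, Real.log_inv] at hN
  linarith

/-- One iteration of the purification procedure finds a community contained in `S₁`. -/
theorem le_prob_purifyOnce {θ α β B : ℝ} (hβ : 0 ≤ β) (hαβ : β < α) (hα1 : α ≤ 1) (hB : 0 < B)
    {S : Finset (Fin n)} (hS : S.Nonempty) (h : IsCommunity π θ α β S) {S₁ : Finset (Fin n)}
    (hSS₁ : S ⊆ S₁) (hS₁ : (S₁.card : ℝ) ≤ B * S.card) {k₂ : ℕ}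
    (hk₂ : Real.exp (-(k₂ * (α - β) ^ 2 / 16)) ≤ (α - β) / (4 * B)) :
    ENNReal.ofReal ((1 / B) ^ k₂ / 2) ≤
      prob (purifyOnce π θ α β S.card k₂ S₁) {A | A = S} := by
  have ht : (0 : ℝ) < S.card := by exact_mod_cast hS.card_pos
  have hγ : 0 < α - β := by linarith
  have hne := hS.mono hSS₁
  rw [purifyOnce, dif_pos hne, prob_map]
  -- The change of measure: from here on the draws may be taken from `S`, at the price of the factor
  -- `1 / B` for each of them.
  have hdom : ∀ a, ENNReal.ofReal (1 / B) * PMF.uniformOfFinset S hS a ≤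
      PMF.uniformOfFinset S₁ hne a := by
    intro a
    by_cases ha : a ∈ S
    · rw [PMF.uniformOfFinset_apply_of_mem _ ha, PMF.uniformOfFinset_apply_of_mem _ (hSS₁ ha),
        ← ENNReal.ofReal_natCast, ← ENNReal.ofReal_natCast, ← ENNReal.ofReal_inv_of_pos ht,
        ← ENNReal.ofReal_inv_of_pos (by exact_mod_cast hne.card_pos),
        ← ENNReal.ofReal_mul (by positivity)]
      refine ENNReal.ofReal_le_ofReal ?_
      rw [one_div, ← mul_inv]
      exact inv_anti₀ (by exact_mod_cast hne.card_pos) hS₁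
    · simp [PMF.uniformOfFinset_apply_of_notMem _ ha]
  have h1 := ev_iid_dominated hdom k₂ fun U =>
    if U ∈ (fun U => recover π θ α β S.card (refine π θ α β S.card S₁ U)) ⁻¹' {A | A = S}
      then 1 else 0
  rw [← prob_eq_ev, ← prob_eq_ev] at h1
  refine le_trans ?_ h1
  rw [div_eq_mul_inv, ENNReal.ofReal_mul (by positivity), ENNReal.ofReal_pow (by positivity)]
  gcongr
  -- The expected number of errors is at most `B t · γ/(4 B) = γ t / 4`, half of what `recover_eq`
  -- tolerates; hence the probability one half.
  have h2 := prob_card_symmDiff_le (iid (PMF.uniformOfFinset S hS) k₂) S S₁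
    (fun U => refine π θ α β S.card S₁ U) ?_ (e := (α - β) / 2 * S.card) (by positivity) _
    (Finset.sum_le_card_nsmul _ _ _ fun i hi =>
      prob_mem_symmDiff_refine_le hβ hαβ hα1 hS h k₂ hi)
  · have h3 : prob (iid (PMF.uniformOfFinset S hS) k₂)
        {U | (α - β) / 2 * S.card ≤ (symmDiff S (refine π θ α β S.card S₁ U)).card} ≤
          ENNReal.ofReal 2⁻¹ := by
      refine h2.trans ?_
      rw [nsmul_eq_mul, ← ENNReal.ofReal_natCast, ← ENNReal.ofReal_mul (by positivity),
        ← ENNReal.ofReal_div_of_pos (by positivity)]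
      refine ENNReal.ofReal_le_ofReal ?_
      rw [div_le_iff₀ (by positivity)]
      calc _ ≤ B * S.card * ((α - β) / (4 * B)) := by gcongr
        _ = _ := by
          field_simp
          norm_num
    have h4 : ENNReal.ofReal 2⁻¹ = 1 - ENNReal.ofReal 2⁻¹ := by
      rw [← ENNReal.ofReal_one, ← ENNReal.ofReal_sub _ (by norm_num)]
      norm_num
    rw [h4]
    refine one_sub_le_prob (le_trans (prob_mono_support fun U _ hU => ?_) h3)
    by_contra hlt
    simp only [Set.mem_ofPred_eq, not_le] at hlt
    exact hU (recover_eq hβ hαβ hα1 h hlt)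
  · intro U _ i hi
    rcases Finset.mem_symmDiff.1 hi with hi | hi
    · exact hSS₁ hi.1
    · exact (mem_refine.1 hi.1).1

/-- All `N` independent iterations miss `S` with probability at most `(1 - q)^N ≤ e^{-qN}`, where `q
= B⁻ᵏ² / 2`. The final filter keeps `S` because it is a community. -/
theorem le_prob_purify {θ α β B η : ℝ} (hβ : 0 ≤ β) (hαβ : β < α) (hα1 : α ≤ 1) (hB : 0 < B)
    {S : Finset (Fin n)} (hS : S.Nonempty) (h : IsCommunity π θ α β S) {S₁ : Finset (Fin n)}
    (hSS₁ : S ⊆ S₁) (hS₁ : (S₁.card : ℝ) ≤ B * S.card) {k₂ N : ℕ}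
    (hk₂ : Real.exp (-(k₂ * (α - β) ^ 2 / 16)) ≤ (α - β) / (4 * B)) (hη : 0 < η)
    (hN : 2 * B ^ k₂ * Real.log (1 / η) ≤ N) :
    ENNReal.ofReal (1 - η) ≤ prob (purify π θ α β S.card k₂ N S₁) {L | S ∈ L} := by
  have h1 := le_prob_purifyOnce hβ hαβ hα1 hB hS h hSS₁ hS₁ hk₂
  rw [purify, prob_map, ENNReal.ofReal_sub _ hη.le, ENNReal.ofReal_one]
  refine one_sub_le_prob (le_trans (prob_mono_support fun L _ hL => ?_)
    ((prob_iid_forall (purifyOnce π θ α β S.card k₂ S₁) {A | A = S}ᶜ N).trans_le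
      ((pow_le_pow_left' (prob_compl_le h1) N).trans (pow_one_sub_le (by positivity) hη ?_))))
  · intro A hA hAS
    have hAS' : A = S := hAS
    refine hL ?_
    simp only [Set.mem_preimage, Set.mem_ofPred_eq, List.mem_filter, decide_eq_true_eq]
    exact ⟨hAS' ▸ hA, h⟩
  · have h2 : (1 / B) ^ k₂ / 2 * (N : ℝ) = N / (2 * B ^ k₂) := by
      rw [one_div_pow]
      field_simp
    rw [h2, le_div_iff₀ (by positivity)]
    linarith

/-! ### The sample size -/

/-- Let `ρ` be the argument of the logarithm in the sample size. The first bound makes the logarithm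
positive. The second says that `ρ⁵` exceeds `4 B / γ` for `B = 3 κ² / (α - 1/2)`; it follows from `ρ
≥ 2 κ`, `ρ ≥ κ / (γ (α - 1/2))` and `ρ³ ≥ 8 ≥ 6`. -/
theorem sampleSize_arg_bounds {θ α β δ : ℝ} (hβ : 0 ≤ β) (hαβ : β < α) (hα1 : α ≤ 1)
    (hα : 1 / 2 < α) (hδ : 0 < δ) (hδ1 : δ < 1) {t : ℕ} (hκ : α ≤ ratio θ t) :
    2 ≤ ratio θ t / (δ * (α - β) * (α - 1 / 2)) ∧
      12 * ratio θ t ^ 2 / ((α - 1 / 2) * (α - β)) ≤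
        (ratio θ t / (δ * (α - β) * (α - 1 / 2))) ^ 5 := by
  have ha : 0 < α - 1 / 2 := by linarith
  have hγ : 0 < α - β := by linarith
  have hκ0 : 0 < ratio θ t := by linarith
  set κ := ratio θ t
  have hd : δ * (α - β) ≤ 1 := by nlinarith
  have h2 : 2 ≤ κ / (δ * (α - β) * (α - 1 / 2)) := by
    rw [le_div_iff₀ (by positivity)]
    nlinarith
  refine ⟨h2, ?_⟩
  have h3 : κ / ((α - 1 / 2) * (α - β)) ≤ κ / (δ * (α - β) * (α - 1 / 2)) := by
    refine div_le_div_of_nonneg_left hκ0.le (by positivity) ?_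
    nlinarith [mul_pos hγ ha]
  have h4 : 2 * κ ≤ κ / (δ * (α - β) * (α - 1 / 2)) := by
    rw [le_div_iff₀ (by positivity)]
    have h5 : δ * (α - β) * (α - 1 / 2) ≤ 1 / 2 := by nlinarith
    nlinarith
  set ρ := κ / (δ * (α - β) * (α - 1 / 2))
  calc 12 * κ ^ 2 / ((α - 1 / 2) * (α - β)) = 6 * ((2 * κ) * (κ / ((α - 1 / 2) * (α - β)))) := by
        ring
    _ ≤ 6 * (ρ * ρ) := by gcongr
    _ ≤ ρ ^ 3 * (ρ * ρ) := by
        gcongr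
        nlinarith [pow_le_pow_left₀ (by norm_num) h2 3]
    _ = ρ ^ 5 := by ring

/-- The constant is `80 = 16 · 5`: the 16 cancels the denominator in the exponent and the 5 is the
power of `ρ` in `sampleSize_arg_bounds`. The factor 3 in the bound on `B` leaves room for the rough
approximation found by sampling. -/
theorem exp_sampleSize_le {θ α β δ B : ℝ} (hβ : 0 ≤ β) (hαβ : β < α) (hα1 : α ≤ 1)
    (hα : 1 / 2 < α) (hδ : 0 < δ) (hδ1 : δ < 1) {t : ℕ} (hκ : α ≤ ratio θ t) (hB0 : 0 < B)
    (hB : B ≤ 3 * (ratio θ t ^ 2 / (α - 1 / 2))) :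
    Real.exp (-(sampleSize 80 θ α β δ t * (α - β) ^ 2 / 16)) ≤ (α - β) / (4 * B) := by
  obtain ⟨h2, h5⟩ := sampleSize_arg_bounds hβ hαβ hα1 hα hδ hδ1 hκ
  have ha : 0 < α - 1 / 2 := by linarith
  have hγ : 0 < α - β := by linarith
  have h1 : 80 * Real.log (ratio θ t / (δ * (α - β) * (α - 1 / 2))) / (α - β) ^ 2 ≤
      sampleSize 80 θ α β δ t := Nat.le_ceil _
  rw [div_le_iff₀ (by positivity)] at h1
  set ρ := ratio θ t / (δ * (α - β) * (α - 1 / 2))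
  have hρ : 0 < ρ := by linarith
  calc _ ≤ Real.exp (-(5 * Real.log ρ)) := by
        rw [Real.exp_le_exp]
        linarith
    _ = (ρ ^ 5)⁻¹ := by
        rw [Real.exp_neg, show (5 : ℝ) * Real.log ρ = (5 : ℕ) * Real.log ρ by norm_num,
          Real.exp_nat_mul, Real.exp_log hρ]
    _ ≤ ((α - β) / (4 * B)) := by
        rw [← inv_div]
        refine inv_anti₀ (by positivity) (le_trans ?_ h5)
        calc 4 * B / (α - β) ≤ 4 * (3 * (ratio θ t ^ 2 / (α - 1 / 2))) / (α - β) := by gcongr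
          _ = _ := by
            rw [← div_div]
            ring

theorem sampleSize_pos {θ α β δ : ℝ} (hβ : 0 ≤ β) (hαβ : β < α) (hα1 : α ≤ 1)
    (hα : 1 / 2 < α) (hδ : 0 < δ) (hδ1 : δ < 1) {t : ℕ} (hκ : α ≤ ratio θ t) :
    0 < sampleSize 80 θ α β δ t := by
  have h2 := (sampleSize_arg_bounds hβ hαβ hα1 hα hδ hδ1 hκ).1
  have hγ : 0 < α - β := by linarith
  have := Real.log_pos (by linarith : 1 < ratio θ t / (δ * (α - β) * (α - 1 / 2)))
  unfold sampleSize
  rw [Nat.ceil_pos]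
  positivity

/-- `κ² ≥ α² ≥ 2 α - 1`. It lets the additive one in `card_hitSet_le` be absorbed into the factor 3.
-/
theorem two_le_ratio_sq_div {θ α : ℝ} (hα : 1 / 2 < α) {t : ℕ} (hκ : α ≤ ratio θ t) :
    2 ≤ ratio θ t ^ 2 / (α - 1 / 2) := by
  rw [le_div_iff₀ (by linarith)]
  nlinarith [sq_nonneg (α - 1)]

/-! ## Finding a rough approximation by sampling -/

theorem count_eq_countP_decide (w : List (Fin n)) (u : Fin n) :
    w.count u = w.countP fun a => decide (a = u) := by
  rw [List.count]
  congr 1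

theorem log_two_mul_div_ge {δ : ℝ} (hδ : 0 < δ) (hδ1 : δ < 1) {t : ℕ} (ht : 0 < t) :
    Real.log 2 ≤ Real.log (2 * t / δ) := by
  have ht' : (1 : ℝ) ≤ t := by exact_mod_cast ht
  refine Real.log_le_log (by norm_num) ?_
  rw [le_div_iff₀ hδ]
  nlinarith

/-- Pigeonhole: every element uses up `4 L` draws, where `L = log (2 t / δ)`. Rounding the number of
draws up adds less than one draw, hence at most one element because `4 L ≥ 4 log 2 > 1`. -/
theorem card_hitSet_le {θ α δ : ℝ} (hα : 1 / 2 < α) (hδ : 0 < δ) (hδ1 : δ < 1)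
    {t : ℕ} (ht : 0 < t) {w : List (Fin n)} (hw : w.length = numDraws θ α δ t) :
    ((hitSet δ t w).card : ℝ) ≤ 2 * (ratio θ t ^ 2 * t / (α - 1 / 2)) + 1 := by
  have hL := log_two_mul_div_ge hδ hδ1 ht
  have hl2 := Real.log_two_gt_d9
  have ha : 0 < α - 1 / 2 := by linarith
  set L := Real.log (2 * t / δ) with hLdef
  have h1 : (hitSet δ t w).card * (4 * L) ≤ w.length := by
    rw [← nsmul_eq_mul]
    refine (Finset.card_nsmul_le_sum _ (fun u => (w.count u : ℝ)) _
      fun u hu => (Finset.mem_filter.1 hu).2).trans ?_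
    have h3 : ∑ u ∈ hitSet δ t w, w.count u ≤ w.length := by
      rw [← Multiset.coe_card, ← Multiset.toFinset_sum_count_eq]
      refine (Finset.sum_le_sum_of_ne_zero fun u _ hu => ?_).trans
        (le_of_eq (Finset.sum_congr rfl fun u _ => (Multiset.coe_count u w).symm))
      simpa using List.count_pos_iff.1 (Nat.pos_of_ne_zero hu)
    rw [← Nat.cast_sum]
    exact Nat.cast_le.2 h3
  have hL0 : 0 ≤ L := by linarith
  have h2 : (numDraws θ α δ t : ℝ) < 8 * ratio θ t ^ 2 * t / (α - 1 / 2) * L + 1 :=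
    Nat.ceil_lt_add_one (by positivity)
  rw [hw] at h1
  have h4 : 8 * ratio θ t ^ 2 * t / (α - 1 / 2) * L =
    2 * (ratio θ t ^ 2 * t / (α - 1 / 2)) * (4 * L) := by ring
  have h5 : (hitSet δ t w).card * (4 * L) ≤
      (2 * (ratio θ t ^ 2 * t / (α - 1 / 2)) + 1) * (4 * L) := by
    rw [add_mul]
    linarith
  exact le_of_mul_le_mul_right h5 (by linarith)

/-- With `q` the hitting probability of `u` and `X` its number of hits, `E[2^{-X}] = (1 - q/2)^m ≤
e^{-qm/2}`, and `q m ≥ 8 L`. Markov's inequality at `4 L` gives `e^{4 L log 2 - 4 L} ≤ e^{-L}`,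
since `log 2 < 3/4`. -/
theorem prob_hit_le {θ α δ : ℝ} (hθ : 0 < θ) (hα : 1 / 2 < α) (hδ : 0 < δ) (hδ1 : δ < 1)
    {t : ℕ} (ht : 0 < t) {v u : Fin n} (h : threshold θ α t ≤ (walk π (quota θ t) v u).toReal) :
    prob (iid (walk π (quota θ t) v) (numDraws θ α δ t)) {w | u ∉ hitSet δ t w} ≤
      ENNReal.ofReal (δ / (2 * t)) := by
  have hL := log_two_mul_div_ge hδ hδ1 ht
  have hl2 := Real.log_two_gt_d9
  have hl3 := Real.log_two_lt_d9
  have ha : 0 < α - 1 / 2 := by linarith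
  have ht' : (0 : ℝ) < t := by exact_mod_cast ht
  have hp : prob (walk π (quota θ t) v) {a | decide (a = u) = true} =
      walk π (quota θ t) v u := by
    simp only [decide_eq_true_eq]
    exact PMF.toOuterMeasure_apply_singleton _ _
  set p := walk π (quota θ t) v
  set m := numDraws θ α δ t with hm
  set L := Real.log (2 * t / δ) with hLdef
  set q := (p u).toReal
  have hq : 0 ≤ q := ENNReal.toReal_nonneg
  have h1 := (mul_prob_le_ev (p := iid p m) (E := {w | u ∉ hitSet δ t w})
    (f := fun l => ENNReal.ofReal (Real.exp (-Real.log 2)) ^ l.countP fun a => decide (a = u))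
    (c := ENNReal.ofReal (Real.exp (-Real.log 2 * (4 * L)))) ?_).trans_eq
    (ev_iid_pow_countP p (fun a => decide (a = u)) _ m)
  · have h2 : ev p (fun a => if decide (a = u) then ENNReal.ofReal (Real.exp (-Real.log 2)) else 1)
        ≤ ENNReal.ofReal (Real.exp (-(q / 2))) := by
      rw [ev_ite, prob_compl_eq_ofReal, prob_eq_ofReal_toReal p {a | _}, hp]
      have hq1 : q ≤ 1 := by
        have := toReal_prob_le_one p {a | decide (a = u) = true}
        rwa [hp] at this
      rw [ENNReal.toReal_ofReal hq, mul_one, ← ENNReal.ofReal_mul hq,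
        ← ENNReal.ofReal_add (by positivity) (by linarith)]
      refine ENNReal.ofReal_le_ofReal ?_
      rw [Real.exp_neg, Real.exp_log (by norm_num)]
      linarith [Real.one_sub_le_exp_neg (q / 2)]
    have h3 := h1.trans (pow_le_pow_left' h2 m)
    rw [ofReal_exp_pow] at h3
    refine (le_ofReal_div_of_mul_le (Real.exp_pos _) h3).trans (ENNReal.ofReal_le_ofReal ?_)
    rw [← Real.exp_sub, ← Real.le_log_iff_exp_le (by positivity)]
    have h4 : Real.log (δ / (2 * t)) = -L := by
      rw [hLdef, ← Real.log_inv, inv_div]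
    rw [h4]
    have h5 : 8 * ratio θ t ^ 2 * t / (α - 1 / 2) * L ≤ m := Nat.le_ceil _
    have h6 : 8 * L ≤ q * m := by
      calc 8 * L = threshold θ α t * (ratio θ t ^ 2 * t / (α - 1 / 2)) * (8 * L) := by
            rw [threshold_mul hθ hα ht, one_mul]
        _ = threshold θ α t * (8 * ratio θ t ^ 2 * t / (α - 1 / 2) * L) := by ring
        _ ≤ q * m := by
          have := threshold_pos hθ hα ht
          have hL0 : 0 ≤ L := by linarith
          gcongr
    nlinarith
  · intro w hw
    rw [ofReal_exp_pow]
    refine ENNReal.ofReal_le_ofReal (Real.exp_le_exp.2 ?_)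
    simp only [hitSet, Set.mem_ofPred_eq, Finset.mem_filter, Finset.mem_univ, true_and,
      not_le] at hw
    rw [count_eq_countP_decide] at hw
    nlinarith

theorem le_prob_subset_hitSet {θ α δ : ℝ} (hθ : 0 < θ) (hα : 1 / 2 < α) (hδ : 0 < δ)
    (hδ1 : δ < 1) {S : Finset (Fin n)} (hS : S.Nonempty) {v : Fin n}
    (hv : v ∈ goodSeeds π θ α S) :
    ENNReal.ofReal (1 - δ / 2) ≤
      prob (iid (walk π (quota θ S.card) v) (numDraws θ α δ S.card))
        {w | S ⊆ hitSet δ S.card w} := by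
  have ht : (0 : ℝ) < S.card := by exact_mod_cast hS.card_pos
  rw [ENNReal.ofReal_sub _ (by positivity), ENNReal.ofReal_one]
  refine one_sub_le_prob ((prob_biUnion_le _ S _ (fun u => {w | u ∉ hitSet δ S.card w})
    fun w hw => ?_).trans ((Finset.sum_le_card_nsmul _ _ _ fun u hu =>
      prob_hit_le hθ hα hδ hδ1 hS.card_pos ((Finset.mem_filter.1 hv).2 u hu)).trans_eq ?_))
  · simpa [Finset.not_subset] using hw
  · rw [nsmul_eq_mul, ← ENNReal.ofReal_natCast, ← ENNReal.ofReal_mul ht.le]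
    congr 1
    field_simp

/-- A bound from a good seed passes to a uniform seed. -/
theorem le_prob_bind_uniform {θ α β x : ℝ} (hθ : 0 < θ) {S : Finset (Fin n)}
    (hS : S.Nonempty) (h : IsCommunity π θ α β S) {Ω : Type*} (q : Fin n → PMF Ω)
    (E : Set Ω) (hx : 0 ≤ x)
    (hq : ∀ v ∈ goodSeeds π θ α S, ENNReal.ofReal x ≤ prob (q v) E) :
    ENNReal.ofReal ((2 * α - 1) * x) ≤ prob ((PMF.uniformOfFinset S hS).bind q) E := by
  have ht : (0 : ℝ) < S.card := by exact_mod_cast hS.card_pos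
  rw [prob_bind, ev_uniformOfFinset]
  have h1 : ENNReal.ofReal ((goodSeeds π θ α S).card * x) ≤ ∑ v ∈ S, prob (q v) E := by
    rw [ENNReal.ofReal_mul (Nat.cast_nonneg _), ENNReal.ofReal_natCast, ← nsmul_eq_mul]
    exact (Finset.card_nsmul_le_sum _ _ _ hq).trans
      (Finset.sum_le_sum_of_subset (Finset.filter_subset _ _))
  refine le_trans ?_ (mul_le_mul_right h1 _)
  rw [← ENNReal.ofReal_natCast, ← ENNReal.ofReal_inv_of_pos ht,
    ← ENNReal.ofReal_mul (by positivity)]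
  refine ENNReal.ofReal_le_ofReal ?_
  have h2 := mul_le_mul_of_nonneg_right (card_goodSeeds_ge hθ hS h) hx
  rw [inv_mul_eq_div, le_div_iff₀ ht]
  linarith

/-- Sampling and purification each get half of the failure probability; `(1 - δ/2)² ≥ 1 - δ`. -/
theorem le_prob_sampledLocal {θ α β δ : ℝ} (hθ : 0 < θ) (hβ : 0 ≤ β) (hαβ : β < α) (hα1 : α ≤ 1)
    (hα : 1 / 2 < α) (hδ : 0 < δ) (hδ1 : δ < 1) {S : Finset (Fin n)} (hS : S.Nonempty)
    (h : IsCommunity π θ α β S) {k₂ N : ℕ} (hk₂ : k₂ = sampleSize 80 θ α β δ S.card)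
    (hN : N = ⌈(80 * ratio θ S.card ^ 2 / (α - 1 / 2)) ^ k₂ * Real.log (2 / δ)⌉₊) {v : Fin n}
    (hv : v ∈ goodSeeds π θ α S) :
    ENNReal.ofReal (1 - δ) ≤ prob (sampledLocal π θ α β δ S.card k₂ N v) {L | S ∈ L} := by
  have hκ := le_ratio hS h
  have hM := two_le_ratio_sq_div hα hκ
  have ha : 0 < α - 1 / 2 := by linarith
  have ht : (1 : ℝ) ≤ S.card := by exact_mod_cast hS.card_pos
  rw [sampledLocal, prob_bind]
  have h1 : ENNReal.ofReal (1 - δ) ≤ ENNReal.ofReal (1 - δ / 2) * ENNReal.ofReal (1 - δ / 2) := by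
    rw [← ENNReal.ofReal_mul (by linarith)]
    refine ENNReal.ofReal_le_ofReal ?_
    nlinarith
  have h2 := mul_le_mul_right (le_prob_subset_hitSet hθ hα hδ hδ1 hS hv)
    (ENNReal.ofReal (1 - δ / 2))
  refine h1.trans (h2.trans ?_)
  rw [prob_eq_ev, ← ev_const_mul]
  refine ev_mono_support fun w hw => ?_
  by_cases hSw : w ∈ {w | S ⊆ hitSet δ S.card w}
  swap
  · simp [hSw]
  rw [if_pos hSw, mul_one]
  have hcard := card_hitSet_le hα hδ hδ1 hS.card_pos (length_of_mem_support_iid hw)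
  set M := ratio θ S.card ^ 2 / (α - 1 / 2) with hMdef
  refine le_prob_purify (B := 3 * M) hβ hαβ hα1 (by positivity) hS h hSw ?_ ?_ (by positivity) ?_
  · have : ratio θ S.card ^ 2 * S.card / (α - 1 / 2) = M * S.card := by ring
    rw [this] at hcard
    nlinarith
  · rw [hk₂]
    exact exp_sampleSize_le hβ hαβ hα1 hα hδ hδ1 hκ (by positivity) le_rfl
  · rw [hN]
    refine le_trans ?_ (Nat.le_ceil _)
    rw [one_div_div]
    have hlog : 0 ≤ Real.log (2 / δ) := by
      refine Real.log_nonneg ?_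
      rw [le_div_iff₀ hδ]
      linarith
    gcongr
    have hk : k₂ ≠ 0 := by
      rw [hk₂]
      exact (sampleSize_pos hβ hαβ hα1 hα hδ hδ1 hκ).ne'
    -- The universal constant sits inside the power, so the factor 2 is moved there as well; this
    -- needs `k₂ ≥ 1`.
    calc 2 * (3 * M) ^ k₂ ≤ 2 ^ k₂ * (3 * M) ^ k₂ := by
          gcongr
          exact le_self_pow₀ (by norm_num) hk
      _ = (6 * M) ^ k₂ := by
          rw [← mul_pow]
          ring
      _ ≤ _ := by
          rw [mul_div_assoc]
          gcongr
          norm_num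

end purification

/-! ## Two rounds of voting -/

section rounds

variable {n : ℕ} {π : Fin n → Equiv.Perm (Fin n)}

/-- The members that get at least `h` votes from the list `U`. -/
def popular (π : Fin n → Equiv.Perm (Fin n)) (k h : ℕ) (U : List (Fin n)) : Finset (Fin n) :=
  Finset.univ.filter fun i => h ≤ U.countP fun u => decide (i ∈ top π k u)

/-- The expected number of errors when `X` is to be found from the votes of a random list of
members of `A`. -/
theorem sum_prob_mem_symmDiff_popular_le {k h m : ℕ} {A X : Finset (Fin n)} (hA : A.Nonempty)
    {b c η : ℝ} (hb : 0 ≤ b) (hη : 0 < η) (hη1 : η ≤ 1) (hbc : b + η ≤ c) (hm : 0 < m)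
    (hh : (h : ℝ) = c * m) (hin : ∀ i ∈ X, (c + η) * A.card ≤ votes π k A i)
    (hout : ∀ j, j ∉ X → (votes π k A j : ℝ) ≤ b * A.card) :
    ∑ i, prob (iid (PMF.uniformOfFinset A hA) m) {U | i ∈ symmDiff X (popular π k h U)} ≤
      ENNReal.ofReal ((X.card + k * (2 / η)) * Real.exp (-(m * η ^ 2 / 4))) := by
  have ht : (0 : ℝ) < A.card := by exact_mod_cast hA.card_pos
  set p := PMF.uniformOfFinset A hA with hp
  set ε := Real.exp (-(m * η ^ 2 / 4))
  have h1 : ∀ i, prob (iid p m) {U | i ∈ symmDiff X (popular π k h U)} ≤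
      (if i ∈ X then ENNReal.ofReal ε else 0) +
        prob p {s | decide (i ∈ top π k s) = true} * ENNReal.ofReal (2 / η * ε) := by
    intro i
    by_cases hi : i ∈ X
    · rw [if_pos hi]
      refine le_trans ?_ le_self_add
      refine le_trans (prob_mono_support fun U _ hU => ?_)
        (prob_iid_countP_lt_le p (fun u => decide (i ∈ top π k u)) (a := c + η)
          (x := h) hη.le hη1 ?_ (by rw [hh]; linarith))
      · simp only [Set.mem_ofPred_eq, Finset.mem_symmDiff, hi, popular, Finset.mem_filter,
          Finset.mem_univ, true_and, not_true_eq_false, and_false, or_false, not_le] at hU ⊢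
        exact_mod_cast hU
      · rw [toReal_prob_uniform_vote, le_div_iff₀ ht]
        exact hin i hi
    · rw [if_neg hi, zero_add]
      -- For points outside `X` the linear tail bound is essential: there may be about `n` of them,
      -- and a uniform bound would sum to something depending on `n`.
      refine le_trans (prob_mono_support fun U _ hU => ?_)
        (prob_iid_le_countP_le_mul p (fun u => decide (i ∈ top π k u)) (b := b)
          (x := h) hη hη1 hb ?_ hm (by rw [hh]; gcongr))
      · simp only [Set.mem_ofPred_eq, Finset.mem_symmDiff, hi, popular, Finset.mem_filter,
          Finset.mem_univ, true_and, false_and, not_false_eq_true, and_true, false_or] at hU ⊢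
        exact_mod_cast hU
      · rw [toReal_prob_uniform_vote, div_le_iff₀ ht]
        exact hout i hi
  refine (Finset.sum_le_sum fun i _ => h1 i).trans ?_
  rw [Finset.sum_add_distrib, Finset.sum_ite_mem, Finset.univ_inter, Finset.sum_const,
    ← Finset.sum_mul, nsmul_eq_mul]
  -- A random voter casts at most `k` votes, so the vote probabilities of all `n` members sum to at
  -- most `k`.
  have h2 : ∑ i, prob p {s | decide (i ∈ top π k s) = true} ≤ ENNReal.ofReal k := by
    have h3 : ∀ i, prob p {s | decide (i ∈ top π k s) = true} =
        ENNReal.ofReal (votes π k A i / A.card) := fun i => by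
      rw [prob_eq_ofReal_toReal, toReal_prob_uniform_vote]
    simp only [h3]
    rw [← ENNReal.ofReal_sum_of_nonneg fun i _ => by positivity]
    refine ENNReal.ofReal_le_ofReal ?_
    rw [← Finset.sum_div, div_le_iff₀ ht, mul_comm]
    exact_mod_cast sum_votes_le π k A Finset.univ
  refine (add_le_add le_rfl (mul_le_mul_left h2 _)).trans_eq ?_
  have hε : 0 < ε := Real.exp_pos _
  rw [← ENNReal.ofReal_natCast, ← ENNReal.ofReal_mul (by positivity),
    ← ENNReal.ofReal_mul (by positivity), ← ENNReal.ofReal_add (by positivity) (by positivity)]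
  congr 1
  ring

/-- The votes of random members of an approximation of `S` determine `S`. -/
theorem half_le_prob_popular_eq {θ α β c η : ℝ} {k h m : ℕ} {S A : Finset (Fin n)}
    (hS : S.Nonempty) (hk : k = quota θ S.card) (hcom : IsCommunity π θ α β S) (hβ : 0 ≤ β)
    (hα1 : α ≤ 1) (hη : 0 < η) (hη8 : α - β = 8 * η) (hc : β + 3 * η ≤ c) (hc' : c + 3 * η ≤ α)
    (hm : 0 < m) (hh : (h : ℝ) = c * m) (hA : A.Nonempty)
    (hSA : ((symmDiff S A).card : ℝ) < η * S.card)
    (hexp : (S.card + k * (2 / η)) * Real.exp (-(m * η ^ 2 / 4)) ≤ 1 / 2) :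
    ENNReal.ofReal (1 / 2) ≤
      prob (iid (PMF.uniformOfFinset A hA) m) {W | popular π k h W = S} := by
  subst hk
  -- Replacing `S` by `A` shifts the comparison of votes with thresholds by at most `η t`. Of the
  -- margin `3 η` on each side of `c`, one `η` pays for this, one is the deviation in the tail
  -- bounds, and one is spare. An expected number of errors of at most one half then bounds the
  -- probability of any error.
  have h1 : prob (iid (PMF.uniformOfFinset A hA) m) {W | popular π (quota θ S.card) h W = S}ᶜ ≤
      ENNReal.ofReal (1 / 2) := by
    refine (prob_biUnion_le _ Finset.univ _
      (fun i => {U | i ∈ symmDiff S (popular π (quota θ S.card) h U)}) fun W hW => ?_).trans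
      ((sum_prob_mem_symmDiff_popular_le hA (b := c - η) (c := c) (by linarith) hη (by linarith)
        (by linarith) hm hh ?_ ?_).trans (ENNReal.ofReal_le_ofReal hexp))
    · have : (symmDiff S (popular π (quota θ S.card) h W)).Nonempty :=
        Finset.symmDiff_nonempty.2 fun he => hW he.symm
      obtain ⟨i, hi⟩ := this
      exact ⟨i, Finset.mem_univ i, hi⟩
    all_goals
      rw [card_symmDiff'] at hSA
      push_cast at hSA
      have hcard : (_ : ℝ) = _ := congrArg (Nat.cast : ℕ → ℝ) (card_add_card_sdiff S A)
      push_cast at hcard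
      have ha : (0 : ℝ) ≤ (S \ A).card := Nat.cast_nonneg _
      have hb : (0 : ℝ) ≤ (A \ S).card := Nat.cast_nonneg _
      have ht : (0 : ℝ) < S.card := by exact_mod_cast hS.card_pos
      intro i hi
    · have h1 := hcom.inside i hi
      have h2 : (_ : ℝ) ≤ _ :=
        (Nat.cast_le (α := ℝ)).2 (votes_le_votes_add π (quota θ S.card) S A i)
      push_cast at h2
      have h3 : (A.card : ℝ) = S.card + (A \ S).card - (S \ A).card := by linarith
      rw [h3]
      nlinarith
    · have h1 := hcom.outside i hi
      have h2 : (_ : ℝ) ≤ _ :=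
        (Nat.cast_le (α := ℝ)).2 (votes_le_votes_add π (quota θ S.card) A S i)
      push_cast at h2
      have h3 : (A.card : ℝ) = S.card + (A \ S).card - (S \ A).card := by linarith
      rw [h3]
      nlinarith
  have h4 : ENNReal.ofReal (1 / 2) = 1 - ENNReal.ofReal (1 / 2) := by
    rw [← ENNReal.ofReal_one, ← ENNReal.ofReal_sub _ (by norm_num)]
    norm_num
  rw [h4]
  exact one_sub_le_prob h1

/-- The probability that the votes of `m` random members of `A` determine `S`. -/
def secondRound (π : Fin n → Equiv.Perm (Fin n)) (k h m : ℕ) (S A : Finset (Fin n)) : ℝ≥0∞ :=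
  if hA : A.Nonempty then prob (iid (PMF.uniformOfFinset A hA) m) {W | popular π k h W = S} else 0

/-- If the first voters were uniform in `S`, the expected number of errors would be at most `η t /
2`. Markov's inequality then gives probability one half for fewer than `η t` errors, and the second
round succeeds with probability one half. Domination turns draws from `S` into draws from `p`. Only
`m₂` enters the exponential loss; `m₃` may grow with `t`. -/
theorem le_ev_secondRound {θ α β c η B : ℝ} {k h₂ m₂ h₃ m₃ : ℕ} {S : Finset (Fin n)}
    (hS : S.Nonempty) (hk : k = quota θ S.card) (hcom : IsCommunity π θ α β S) (hβ : 0 ≤ β)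
    (hα1 : α ≤ 1) (hη : 0 < η) (hη8 : α - β = 8 * η) (hc : β + 3 * η ≤ c) (hc' : c + 3 * η ≤ α)
    (hm₂ : 0 < m₂) (hh₂ : (h₂ : ℝ) = c * m₂) (hm₃ : 0 < m₃) (hh₃ : (h₃ : ℝ) = c * m₃)
    (hexp₂ : (S.card + k * (2 / η)) * Real.exp (-(m₂ * η ^ 2 / 4)) ≤ η * S.card / 2)
    (hexp₃ : (S.card + k * (2 / η)) * Real.exp (-(m₃ * η ^ 2 / 4)) ≤ 1 / 2)
    (hB : 0 < B) {p : PMF (Fin n)} (hp : ∀ u ∈ S, 1 / (B * S.card) ≤ (p u).toReal) :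
    ENNReal.ofReal ((1 / B) ^ m₂ / 4) ≤
      ev (iid p m₂) fun U => secondRound π k h₃ m₃ S (popular π k h₂ U) := by
  have ht : (0 : ℝ) < S.card := by exact_mod_cast hS.card_pos
  have hdom : ∀ a, ENNReal.ofReal (1 / B) * PMF.uniformOfFinset S hS a ≤ p a := by
    intro a
    by_cases ha : a ∈ S
    · rw [PMF.uniformOfFinset_apply_of_mem _ ha, ← ENNReal.ofReal_natCast,
        ← ENNReal.ofReal_inv_of_pos ht, ← ENNReal.ofReal_mul (by positivity)]
      refine ENNReal.ofReal_le_of_le_toReal ((le_of_eq ?_).trans (hp a ha))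
      field_simp
    · simp [PMF.uniformOfFinset_apply_of_notMem _ ha]
  refine le_trans ?_ (ev_iid_dominated hdom m₂ _)
  rw [show (1 / B) ^ m₂ / 4 = (1 / B) ^ m₂ * (1 / 2 * (1 / 2)) by ring,
    ENNReal.ofReal_mul (by positivity), ENNReal.ofReal_pow (by positivity),
    ENNReal.ofReal_mul (by norm_num)]
  gcongr
  have h4 : ENNReal.ofReal (1 / 2) = 1 - ENNReal.ofReal (1 / 2) := by
    rw [← ENNReal.ofReal_one, ← ENNReal.ofReal_sub _ (by norm_num)]
    norm_num
  have h5 : ENNReal.ofReal (1 / 2) ≤ prob (iid (PMF.uniformOfFinset S hS) m₂)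
      {U | η * S.card ≤ (symmDiff S (popular π k h₂ U)).card}ᶜ := by
    conv_lhs => rw [h4]
    refine one_sub_le_prob ?_
    rw [compl_compl]
    refine (prob_card_symmDiff_le _ S Finset.univ (fun U => popular π k h₂ U)
      (fun _ _ => Finset.subset_univ _) (by positivity) _
      (sum_prob_mem_symmDiff_popular_le hS (b := β) (c := c) hβ hη (by linarith) (by linarith)
        hm₂ hh₂ ?_ ?_)).trans ?_
    · intro i hi
      rw [hk]
      exact le_trans (by gcongr; linarith) (hcom.inside i hi)
    · intro j hj
      rw [hk]
      exact hcom.outside j hj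
    · rw [← ENNReal.ofReal_div_of_pos (by positivity)]
      refine ENNReal.ofReal_le_ofReal ?_
      rw [div_le_iff₀ (by positivity)]
      linarith
  refine (mul_le_mul_right h5 _).trans (mul_prob_le_ev fun U hU => ?_)
  have hU' : ((symmDiff S (popular π k h₂ U)).card : ℝ) < η * S.card := lt_of_not_ge hU
  -- An empty set would be wrong in all `t` places, but `η ≤ 1/8`.
  have hne : (popular π k h₂ U).Nonempty := by
    rw [Finset.nonempty_iff_ne_empty]
    intro he
    rw [he, ← Finset.bot_eq_empty, symmDiff_bot] at hU'
    nlinarith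
  rw [secondRound, dif_pos hne]
  exact half_le_prob_popular_eq hS hk hcom hβ hα1 hη hη8 hc hc' hm₃ hh₃ hne hU' hexp₃

end rounds

/-! ## Reasoning about programs -/

section semantics

variable {n : ℕ} {π : Fin n → Equiv.Perm (Fin n)}

/-- Every final state that has positive probability satisfies `Q`. -/
def Post (π : Fin n → Equiv.Perm (Fin n)) (p : Prog) (s : State) (Q : State → Prop) : Prop :=
  ∀ x ∈ (exec π p s).support, Q x.1

/-- The expectation of a function of the final state. -/
def wp (π : Fin n → Equiv.Perm (Fin n)) (p : Prog) (s : State) (f : State → ℝ≥0∞) : ℝ≥0∞ :=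
  ev (exec π p s) fun x => f x.1

theorem Post.mono {p : Prog} {s : State} {Q R : State → Prop} (h : Post π p s Q)
    (hQR : ∀ s', Q s' → R s') : Post π p s R := fun x hx => hQR _ (h x hx)

section rules

variable {s : State} {Q : State → Prop} {x y z a c : ℕ} {p q : Prog}

theorem post_const : Post π (.const x c) s Q ↔ Q (s.set x c) := by
  simp [Post, exec]

theorem post_add : Post π (.add x y z) s Q ↔ Q (s.set x (s.reg y + s.reg z)) := by
  simp [Post, exec]

theorem post_load : Post π (.load x a y) s Q ↔ Q (s.set x (s.arr a (s.reg y))) := by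
  simp [Post, exec]

theorem post_store : Post π (.store a x y) s Q ↔ Q (s.write a (s.reg x) (s.reg y)) := by
  simp [Post, exec]

theorem post_query : Post π (.query x y z) s Q ↔ Q (s.ask π x (s.reg y) (s.reg z)) := by
  simp [Post, exec]

theorem post_emit : Post π (.emit x) s Q ↔ Q (s.put (s.reg x)) := by
  simp [Post, exec]

theorem post_seq : Post π (.seq p q) s Q ↔ Post π p s fun s' => Post π q s' Q := by
  simp only [Post, exec, PMF.mem_support_bind_iff, PMF.mem_support_map_iff]
  constructor
  · intro h x hx y hy
    exact h (y.1, x.2 + y.2) ⟨x, hx, y, hy, rfl⟩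
  · rintro h _ ⟨x, hx, y, hy, rfl⟩
    exact h x hx y hy

theorem post_ite : Post π (.ite x y p q) s Q ↔
    if s.reg x ≤ s.reg y then Post π p s Q else Post π q s Q := by
  simp only [Post, exec, PMF.mem_support_map_iff]
  split_ifs <;> constructor
  · intro h x hx
    exact h (x.1, x.2 + 1) ⟨x, hx, rfl⟩
  · rintro h _ ⟨x, hx, rfl⟩
    exact h x hx
  · intro h x hx
    exact h (x.1, x.2 + 1) ⟨x, hx, rfl⟩
  · rintro h _ ⟨x, hx, rfl⟩
    exact h x hx

/-- The number of passes is read once at entry, so the invariant need not protect the register `x`.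
-/
theorem post_loop {Inv : ℕ → State → Prop} (h0 : Inv 0 s)
    (hstep : ∀ j s', j < s.reg x → Inv j s' → Post π p s' (Inv (j + 1))) :
    Post π (.loop x p) s (Inv (s.reg x)) := by
  have key : ∀ m j s', j + m = s.reg x → Inv j s' →
      ∀ y ∈ (iterate (exec π p) m s').support, Inv (s.reg x) y.1 := by
    intro m
    induction m with
    | zero =>
      intro j s' hj hs' y hy
      simp only [iterate, PMF.mem_support_pure_iff] at hy
      subst hy
      rw [← hj]
      exact hs'
    | succ m ih =>
      intro j s' hj hs' y hy
      simp only [iterate, PMF.mem_support_bind_iff, PMF.mem_support_map_iff] at hy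
      obtain ⟨x', hx', y', hy', rfl⟩ := hy
      exact ih (j + 1) x'.1 (by omega) (hstep j s' (by omega) hs' x' hx') y' hy'
  intro y hy
  simp only [exec, PMF.mem_support_map_iff] at hy
  obtain ⟨y', hy', rfl⟩ := hy
  exact key _ 0 s (by omega) h0 y' hy'

variable {f : State → ℝ≥0∞}

theorem wp_const : wp π (.const x c) s f = f (s.set x c) := by
  simp [wp, exec, ev_pure]

theorem wp_load : wp π (.load x a y) s f = f (s.set x (s.arr a (s.reg y))) := by
  simp [wp, exec, ev_pure]

theorem wp_query : wp π (.query x y z) s f = f (s.ask π x (s.reg y) (s.reg z)) := by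
  simp [wp, exec, ev_pure]

theorem wp_newSet : wp π .newSet s f = f { s with out := ∅ :: s.out } := by
  simp [wp, exec, ev_pure]

theorem wp_rand : wp π (.rand x y) s f = ev (randBelow (s.reg y)) fun c => f (s.set x c) := by
  simp [wp, exec, ev_map]

theorem wp_seq : wp π (.seq p q) s f = wp π p s fun s' => wp π q s' f := by
  simp [wp, exec, ev_bind, ev_map]

theorem wp_loop : wp π (.loop x p) s f =
    ev (iterate (exec π p) (s.reg x) s) fun y => f y.1 := by
  simp [wp, exec, ev_map]

theorem Post.le_wp {e : ℝ≥0∞} (h : Post π p s Q) (he : ∀ s', Q s' → e ≤ f s') :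
    e ≤ wp π p s f := by
  rw [← ev_const (exec π p s) e]
  exact ev_mono_support fun x hx => he _ (h x hx)

theorem Post.wp_le_const {e : ℝ≥0∞} (h : Post π p s Q) (he : ∀ s', Q s' → f s' ≤ e) :
    wp π p s f ≤ e := by
  rw [← ev_const (exec π p s) e]
  exact ev_mono_support fun x hx => he _ (h x hx)

end rules

/-- A loop whose body processes one draw from `p` processes independent draws from `p`. -/
theorem ev_iid_le_wp_loop {Ω : Type*} {Inv : State → List Ω → Prop} {p : PMF Ω} {body : Prog}
    (hstep : ∀ s U, Inv s U → ∀ (f : State → ℝ≥0∞) (g : Ω → ℝ≥0∞),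
      (∀ s' u, Inv s' (U ++ [u]) → g u ≤ f s') → ev p g ≤ wp π body s f)
    {x : ℕ} {s : State} (hs : Inv s []) (f : State → ℝ≥0∞) (g : List Ω → ℝ≥0∞)
    (hfg : ∀ s' W, Inv s' W → g W ≤ f s') :
    ev (iid p (s.reg x)) g ≤ wp π (.loop x body) s f := by
  have key : ∀ m s U, Inv s U → ∀ g : List Ω → ℝ≥0∞,
      (∀ s' W, Inv s' (U ++ W) → g W ≤ f s') →
        ev (iid p m) g ≤ ev (iterate (exec π body) m s) fun y => f y.1 := by
    intro m
    induction m with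
    | zero =>
      intro s U hs g hfg
      simp only [iid, iterate, ev_pure]
      exact hfg s [] (by simpa using hs)
    | succ m ih =>
      intro s U hs g hfg
      rw [ev_iid_succ]
      simp only [iterate, ev_bind, ev_map]
      refine hstep s U hs (fun s' => ev (iterate (exec π body) m s') fun y => f y.1) _
        fun s' u hs' => ih s' (U ++ [u]) hs' _ fun s'' W hW => hfg s'' (u :: W) ?_
      simpa using hW
  rw [wp_loop]
  exact key _ s [] hs g fun s' W hW => hfg s' W (by simpa using hW)

/-! ### What a program leaves unchanged, and how long it runs -/

/-- The program does not write to the registers in `F` nor to the arrays in `G`, begins no sets, and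
its loops are controlled by registers in `F`. -/
def Frame (F : Finset ℕ) (G : Set ℕ) : Prog → Prop
  | .const x _ => x ∉ F
  | .add x _ _ => x ∉ F
  | .sub x _ _ => x ∉ F
  | .load x _ _ => x ∉ F
  | .store a _ _ => a ∉ G
  | .query x _ _ => x ∉ F
  | .rand x _ => x ∉ F
  | .newSet => False
  | .emit _ => True
  | .seq p q => Frame F G p ∧ Frame F G q
  | .ite _ _ p q => Frame F G p ∧ Frame F G q
  | .loop x p => x ∈ F ∧ Frame F G p

/-- A bound for the number of steps of a program when the registers that control the loops have
fixed contents. -/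
def cost (r : ℕ → ℕ) : Prog → ℕ
  | .seq p q => cost r p + cost r q
  | .ite _ _ p q => max (cost r p) (cost r q) + 1
  | .loop x p => r x * (cost r p + 1) + 1
  | _ => 1

theorem cost_congr {F : Finset ℕ} {G : Set ℕ} {r r' : ℕ → ℕ} (hr : ∀ x ∈ F, r x = r' x) :
    ∀ p : Prog, Frame F G p → cost r p = cost r' p
  | .seq p q, h => by
    rw [cost, cost, cost_congr hr p h.1, cost_congr hr q h.2]
  | .ite _ _ p q, h => by
    rw [cost, cost, cost_congr hr p h.1, cost_congr hr q h.2]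
  | .loop x p, h => by
    rw [cost, cost, cost_congr hr p h.2, hr x h.1]
  | .const .., _ => rfl
  | .add .., _ => rfl
  | .sub .., _ => rfl
  | .load .., _ => rfl
  | .store .., _ => rfl
  | .query .., _ => rfl
  | .rand .., _ => rfl
  | .newSet, _ => rfl
  | .emit .., _ => rfl

/-- The relation between the initial and the final state of a framed program. -/
structure Framed (F : Finset ℕ) (G : Set ℕ) (s s' : State) : Prop where
  reg : ∀ x ∈ F, s'.reg x = s.reg x
  arr : ∀ a ∈ G, s'.arr a = s.arr a
  seen : s.seen ⊆ s'.seen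
  out : ∀ A L, s.out = A :: L → ∃ A', s'.out = A' :: L

theorem Framed.refl (F : Finset ℕ) (G : Set ℕ) (s : State) : Framed F G s s :=
  ⟨fun _ _ => rfl, fun _ _ => rfl, subset_rfl, fun A _ h => ⟨A, h⟩⟩

theorem Framed.trans {F : Finset ℕ} {G : Set ℕ} {s s' s'' : State} (h : Framed F G s s')
    (h' : Framed F G s' s'') : Framed F G s s'' :=
  ⟨fun x hx => (h'.reg x hx).trans (h.reg x hx), fun a ha => (h'.arr a ha).trans (h.arr a ha),
    h.seen.trans h'.seen, fun A L hA => by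
      obtain ⟨A', hA'⟩ := h.out A L hA
      exact h'.out A' L hA'⟩

theorem Framed.set {F : Finset ℕ} {G : Set ℕ} {s : State} {x : ℕ} (hx : x ∉ F) (c : ℕ) :
    Framed F G s (s.set x c) := by
  refine ⟨fun y hy => ?_, fun _ _ => rfl, subset_rfl, fun A _ h => ⟨A, h⟩⟩
  exact Function.update_of_ne (ne_of_mem_of_not_mem hy hx) _ _

theorem Framed.ask {F : Finset ℕ} {G : Set ℕ} {s : State} {x : ℕ} (hx : x ∉ F) (y z : ℕ) :
    Framed F G s (s.ask π x y z) := by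
  unfold State.ask
  split_ifs with h
  · refine ⟨fun y hy => ?_, fun _ _ => rfl, Finset.subset_insert _ _, fun A _ h => ⟨A, h⟩⟩
    exact Function.update_of_ne (ne_of_mem_of_not_mem hy hx) _ _
  · exact Framed.set hx 0

theorem Framed.write {F : Finset ℕ} {G : Set ℕ} {s : State} {a : ℕ} (ha : a ∉ G) (i c : ℕ) :
    Framed F G s (s.write a i c) := by
  refine ⟨fun _ _ => rfl, fun b hb => ?_, subset_rfl, fun A _ h => ⟨A, h⟩⟩
  exact Function.update_of_ne (ne_of_mem_of_not_mem hb ha) _ _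

theorem Framed.put (F : Finset ℕ) (G : Set ℕ) (s : State) (c : ℕ) : Framed F G s (s.put c) := by
  unfold State.put
  split
  · next h => exact ⟨fun _ _ => rfl, fun _ _ => rfl, subset_rfl, fun A L hA => by simp_all⟩
  · next A L h =>
    refine ⟨fun _ _ => rfl, fun _ _ => rfl, subset_rfl, fun A' L' hA => ⟨insert c A, ?_⟩⟩
    rw [h, List.cons.injEq] at hA
    simp [hA.2]

/-- Framing and timing are proved together: since loop counters are never overwritten, the cost of
every pass can be computed from the initial registers. -/
theorem framed_of_mem_support {F : Finset ℕ} {G : Set ℕ} : ∀ (p : Prog), Frame F G p →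
    ∀ s, ∀ x ∈ (exec π p s).support, Framed F G s x.1 ∧ x.2 ≤ cost s.reg p
  | .const .., h, s, x, hx => by
    simp only [exec, PMF.mem_support_pure_iff] at hx
    subst hx
    exact ⟨Framed.set h _, le_rfl⟩
  | .add .., h, s, x, hx => by
    simp only [exec, PMF.mem_support_pure_iff] at hx
    subst hx
    exact ⟨Framed.set h _, le_rfl⟩
  | .sub .., h, s, x, hx => by
    simp only [exec, PMF.mem_support_pure_iff] at hx
    subst hx
    exact ⟨Framed.set h _, le_rfl⟩
  | .load .., h, s, x, hx => by
    simp only [exec, PMF.mem_support_pure_iff] at hx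
    subst hx
    exact ⟨Framed.set h _, le_rfl⟩
  | .store .., h, s, x, hx => by
    simp only [exec, PMF.mem_support_pure_iff] at hx
    subst hx
    exact ⟨Framed.write h _ _, le_rfl⟩
  | .query .., h, s, x, hx => by
    simp only [exec, PMF.mem_support_pure_iff] at hx
    subst hx
    exact ⟨Framed.ask h _ _, le_rfl⟩
  | .rand .., h, s, x, hx => by
    simp only [exec, PMF.mem_support_map_iff] at hx
    obtain ⟨c, -, rfl⟩ := hx
    exact ⟨Framed.set h _, le_rfl⟩
  | .emit .., _, s, x, hx => by
    simp only [exec, PMF.mem_support_pure_iff] at hx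
    subst hx
    exact ⟨Framed.put _ _ _ _, le_rfl⟩
  | .seq p q, h, s, x, hx => by
    simp only [exec, PMF.mem_support_bind_iff, PMF.mem_support_map_iff] at hx
    obtain ⟨x, hx, y, hy, rfl⟩ := hx
    obtain ⟨h1, h2⟩ := framed_of_mem_support p h.1 s x hx
    obtain ⟨h3, h4⟩ := framed_of_mem_support q h.2 x.1 y hy
    refine ⟨h1.trans h3, add_le_add h2 ?_⟩
    rwa [cost_congr h1.reg q h.2] at h4
  | .ite x y p q, h, s, z, hz => by
    simp only [exec, PMF.mem_support_map_iff] at hz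
    obtain ⟨z, hz, rfl⟩ := hz
    split_ifs at hz
    · obtain ⟨h1, h2⟩ := framed_of_mem_support p h.1 s z hz
      exact ⟨h1, Nat.add_le_add_right (h2.trans (le_max_left _ _)) 1⟩
    · obtain ⟨h1, h2⟩ := framed_of_mem_support q h.2 s z hz
      exact ⟨h1, Nat.add_le_add_right (h2.trans (le_max_right _ _)) 1⟩
  | .loop x p, h, s, z, hz => by
    simp only [exec, PMF.mem_support_map_iff] at hz
    obtain ⟨z, hz, rfl⟩ := hz
    have key : ∀ m s', Framed F G s s' → ∀ y ∈ (iterate (exec π p) m s').support,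
        Framed F G s y.1 ∧ y.2 ≤ m * (cost s.reg p + 1) := by
      intro m
      induction m with
      | zero =>
        intro s' hs' y hy
        simp only [iterate, PMF.mem_support_pure_iff] at hy
        subst hy
        exact ⟨hs', zero_le⟩
      | succ m ih =>
        intro s' hs' y hy
        simp only [iterate, PMF.mem_support_bind_iff, PMF.mem_support_map_iff] at hy
        obtain ⟨x', hx', y', hy', rfl⟩ := hy
        obtain ⟨h1, h2⟩ := framed_of_mem_support p h.2 s' x' hx'
        obtain ⟨h3, h4⟩ := ih x'.1 (hs'.trans h1) y' hy'
        refine ⟨h3, ?_⟩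
        rw [cost_congr hs'.reg p h.2] at h2
        show x'.2 + y'.2 + 1 ≤ _
        rw [Nat.succ_mul]
        omega
    obtain ⟨h1, h2⟩ := key _ s (Framed.refl F G s) z hz
    exact ⟨h1, Nat.add_le_add_right h2 1⟩

end semantics

/-! ## The program -/

section program

/-- Count a vote of member `5` (at position `6`) in the array `a`, and act on the member voted for
when its number of votes reaches the content of register `h`. -/
def tallyStep (a h : ℕ) (act : Prog) : Prog :=
  .seq (.query 7 5 6) <| .seq (.add 6 6 4) <| .seq (.load 8 a 7) <| .seq (.add 8 8 4) <|
    -- Two comparisons test for equality, so that `act` runs only at the vote that reaches the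
    -- threshold and no member is listed twice. Writing to register `15` stands for doing nothing.
    .seq (.store a 7 8) <| .ite 8 h (.ite h 8 act (.const 15 0)) (.const 15 0)

/-- Count all votes of member `5`. -/
def tally (a h : ℕ) (act : Prog) : Prog :=
  .seq (.const 6 0) (.loop 2 (tallyStep a h act))

/-- Append the member in register `7` to the list in array `b`, whose length is in register `9`. -/
def push (b : ℕ) : Prog :=
  .seq (.store b 9 7) (.add 9 9 4)

/-- Count the votes of a member that is found by the two-step vote walk from the seed. -/
def firstRoundStep (j : ℕ) : Prog :=
  .seq (.rand 14 2) <| .seq (.query 5 0 14) <| .seq (.rand 14 2) <| .seq (.query 5 5 14) <|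
    tally (3 * j) 10 (push (3 * j + 1))

/-- Count the votes of a random member of the list. -/
def secondRoundStep (j : ℕ) : Prog :=
  .seq (.rand 14 9) <| .seq (.load 5 (3 * j + 1) 14) <| tally (3 * j + 2) 11 (.emit 7)

/-- The two rounds of voting that find one candidate for the community. -/
def attemptBody (j : ℕ) : Prog :=
  .seq (.const 9 0) <| .seq (.loop 12 (firstRoundStep j)) (.loop 13 (secondRoundStep j))

/-- Repeated attempts, each with its own arrays. -/
def attempts : ℕ → Prog
  | 0 => .const 15 0
  | j + 1 => .seq (.seq .newSet (attemptBody j)) (attempts j)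

/-- Compute the binary length of `t` in register `3`, and write `h` and `m` to their registers. -/
def setupLength (h m : ℕ) : Prog :=
  .seq (.const 4 1) <| .seq (.const 16 1) <|
    -- All loops are counted, so the doubling is given `t` passes, most of which may be idle; this
    -- costs only `O(t)`.
    .seq (.loop 1 (.ite 16 1 (.seq (.add 16 16 16) (.add 3 3 4)) (.const 15 0))) <|
    .seq (.const 10 h) (.const 12 m)

/-- Compute the parameters of the second round. -/
def setupRound : Prog :=
  .seq (.loop 10 (.add 11 11 3)) (.loop 12 (.add 13 13 3))

/-- Compute the parameters of the two rounds. -/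
def setup (h m : ℕ) : Prog := .seq (setupLength h m) setupRound

/-- The local algorithm as a program. -/
def localProg (h m N : ℕ) : Prog := .seq (setup h m) (attempts N)

end program

/-! ### Correctness of the vote counting and of the random choices -/

section correctness

variable {n : ℕ} {π : Fin n → Equiv.Perm (Fin n)}

/-! ### Counting the votes of one member -/

/-- The registers that are used for counting votes. -/
def scratch : Finset ℕ := {6, 7, 8, 9, 15}

/-- The array `a` holds the numbers `f` of votes, and the members with at least `h` votes are
represented. -/
structure Tallied (Rep : State → Finset (Fin n) → Prop) (a h : ℕ) (f : Fin n → ℕ) (s : State) :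
    Prop where
  cnt : ∀ w : Fin n, s.arr a w = f w
  seen : ∀ w : Fin n, 0 < f w → (w : ℕ) ∈ s.seen
  rep : Rep s (Finset.univ.filter fun w => h ≤ f w)

/-- The representation does not depend on the data that are used for counting in the array `a`. -/
def Robust (Rep : State → Finset (Fin n) → Prop) (a : ℕ) : Prop :=
  ∀ s s' T, s'.reg 9 = s.reg 9 → (∀ b, b ≠ a → s'.arr b = s.arr b) → s'.out = s.out →
    s.seen ⊆ s'.seen → Rep s T → Rep s' T

/-- The program adds the member in register `7` to the represented set. -/
def Adds (π : Fin n → Equiv.Perm (Fin n)) (Rep : State → Finset (Fin n) → Prop) (a : ℕ)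
    (act : Prog) : Prop :=
  ∀ (s : State) (T : Finset (Fin n)) (w : Fin n), s.reg 4 = 1 → s.reg 7 = (w : ℕ) → w ∉ T → Rep s T →
    Post π act s fun s' => Rep s' (insert w T) ∧ (∀ x, x ∉ scratch → s'.reg x = s.reg x) ∧
      s'.reg 6 = s.reg 6 ∧ s'.arr a = s.arr a ∧ s'.seen = s.seen

/-- One vote raises one count by one. The set of members above the threshold changes only if the new
count equals the threshold, which is the case in which `act` is run. -/
theorem post_tallyStep {Rep : State → Finset (Fin n) → Prop} {a h : ℕ} {act : Prog}
    (hR : Robust Rep a) (hA : Adds π Rep a act) (hh : h = 10 ∨ h = 11) {f : Fin n → ℕ} {s : State}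
    (hs : Tallied Rep a (s.reg h) f s) (h4 : s.reg 4 = 1) {u z : Fin n} (hu : s.reg 5 = (u : ℕ))
    (hus : (u : ℕ) ∈ s.seen) (hz : s.reg 6 = (z : ℕ)) :
    Post π (tallyStep a h act) s fun s' =>
      Tallied Rep a (s.reg h) (fun w => f w + if w = π u z then 1 else 0) s' ∧
        s'.reg 6 = z + 1 ∧ (∀ x, x ∉ scratch → s'.reg x = s.reg x) ∧ s.seen ⊆ s'.seen := by
  have hask : s.ask π 7 (s.reg 5) (s.reg 6) =
      { (s.set 7 (π u z : ℕ)) with seen := insert (π u z : ℕ) s.seen } := by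
    unfold State.ask
    rw [dif_pos (by rw [hu, hz]; exact ⟨hus, u.isLt, z.isLt⟩)]
    simp only [hu, hz, Fin.eta]
  unfold tallyStep
  simp only [post_seq, post_query, post_add, post_load, post_store, post_ite, post_const, hask]
  set w := π u z with hw
  set s₁ : State := (({ (s.set 7 (w : ℕ)) with seen := insert (w : ℕ) s.seen } : State).set 6
    (z + 1)).set 8 (f w) |>.set 8 (f w + 1) |>.write a w (f w + 1) with hs₁
  have he : (((({ (s.set 7 (w : ℕ)) with seen := insert (w : ℕ) s.seen } : State).set 6
    (z + 1)).set 8 (s.arr a w)).set 8 (s.arr a w + 1)).write a w (s.arr a w + 1) = s₁ := by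
    rw [hs.cnt w]
  have hcnt : ∀ w' : Fin n, s₁.arr a w' = f w' + if w' = w then 1 else 0 := by
    intro w'
    by_cases hww : w' = w
    · subst hww
      simp [hs₁, State.write]
    · have : (w' : ℕ) ≠ w := fun h => hww (Fin.ext h)
      simp [hs₁, State.write, State.set, hww, this, hs.cnt]
  have hseen : s₁.seen = insert (w : ℕ) s.seen := rfl
  have hseen' : ∀ w' : Fin n, 0 < (f w' + if w' = w then 1 else 0) → (w' : ℕ) ∈ s₁.seen := by
    intro w' hw'
    rw [hseen, Finset.mem_insert]
    by_cases hww : w' = w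
    · left
      rw [hww]
    · right
      exact hs.seen w' (by simpa [hww] using hw')
  have hreg : ∀ x, x ∉ scratch → s₁.reg x = s.reg x := by
    intro x hx
    simp only [scratch, Finset.mem_insert, Finset.mem_singleton, not_or] at hx
    simp [hs₁, State.write, State.set, Function.update_of_ne, hx]
  have hrep : Rep s₁ (Finset.univ.filter fun w => s.reg h ≤ f w) := by
    refine hR s s₁ _ ?_ ?_ ?_ ?_ hs.rep
    · simp [hs₁, State.write, State.set]
    · intro b hb
      simp [hs₁, State.write, State.set, hb]
    · rfl
    · rw [hseen]
      exact Finset.subset_insert _ _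
  have h6 : s₁.reg 6 = z + 1 := by simp [hs₁, State.write, State.set]
  have h7 : s₁.reg 7 = w := by simp [hs₁, State.write, State.set]
  have h8 : s₁.reg 8 = f w + 1 := by simp [hs₁, State.write, State.set]
  have hh' : s₁.reg h = s.reg h := hreg h (by rcases hh with rfl | rfl <;> simp [scratch])
  have hskip : (f w + 1 ≠ s.reg h) →
      Tallied Rep a (s.reg h) (fun w' => f w' + if w' = w then 1 else 0) (s₁.set 15 0) ∧
        (s₁.set 15 0).reg 6 = z + 1 ∧ (∀ x, x ∉ scratch → (s₁.set 15 0).reg x = s.reg x) ∧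
          s.seen ⊆ (s₁.set 15 0).seen := by
    intro hne
    refine ⟨⟨hcnt, hseen', ?_⟩, ?_, ?_, ?_⟩
    · refine hR s₁ _ _ (by simp [State.set]) (fun _ _ => rfl) rfl subset_rfl ?_
      have hT : (Finset.univ.filter fun w' => s.reg h ≤ f w' + if w' = w then 1 else 0) =
          Finset.univ.filter fun w' => s.reg h ≤ f w' := by
        refine Finset.filter_congr fun w' _ => ?_
        split_ifs with hww
        · subst hww
          omega
        · simp
      rw [hT]
      exact hrep
    · simpa [State.set] using h6
    · intro x hx
      rw [← hreg x hx]
      simp only [scratch, Finset.mem_insert, Finset.mem_singleton, not_or] at hx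
      simp [State.set, hx]
    · exact hseen.symm ▸ Finset.subset_insert _ _
  have hgoal : ∀ s₂ : State, s₂ = s₁ → (if s₂.reg 8 ≤ s₂.reg h then
      if s₂.reg h ≤ s₂.reg 8 then Post π act s₂ fun s' =>
        Tallied Rep a (s.reg h) (fun w' => f w' + if w' = w then 1 else 0) s' ∧
        s'.reg 6 = z + 1 ∧ (∀ x, x ∉ scratch → s'.reg x = s.reg x) ∧ s.seen ⊆ s'.seen
      else Tallied Rep a (s.reg h) (fun w' => f w' + if w' = w then 1 else 0) (s₂.set 15 0) ∧
        (s₂.set 15 0).reg 6 = z + 1 ∧ (∀ x, x ∉ scratch → (s₂.set 15 0).reg x = s.reg x) ∧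
          s.seen ⊆ (s₂.set 15 0).seen
      else Tallied Rep a (s.reg h) (fun w' => f w' + if w' = w then 1 else 0) (s₂.set 15 0) ∧
        (s₂.set 15 0).reg 6 = z + 1 ∧ (∀ x, x ∉ scratch → (s₂.set 15 0).reg x = s.reg x) ∧
          s.seen ⊆ (s₂.set 15 0).seen) := by
    rintro _ rfl
    rw [h8, hh']
    split_ifs with hc1 hc2
    · have hT : w ∉ Finset.univ.filter fun w => s.reg h ≤ f w := by
        simp only [Finset.mem_filter, Finset.mem_univ, true_and]
        omega
      refine (hA s₁ _ w (by rw [hreg 4 (by simp [scratch]), h4]) h7 hT hrep).mono ?_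
      rintro s' ⟨r1, r2, r3, r4, r5⟩
      refine ⟨⟨fun w' => by rw [r4]; exact hcnt w', fun w' hw' => by rw [r5]; exact hseen' w' hw',
        ?_⟩, r3.trans h6, fun x hx => (r2 x hx).trans (hreg x hx), ?_⟩
      · convert r1 using 1
        ext w'
        simp only [Finset.mem_filter, Finset.mem_univ, true_and, Finset.mem_insert]
        split_ifs with hww
        · subst hww
          simp [hc2]
        · simp [hww]
      · rw [r5, hseen]
        exact Finset.subset_insert _ _
    · exact hskip (by omega)
    · exact hskip (by omega)
  refine hgoal _ ?_
  rw [← he]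
  simp [State.write, State.set, h4, hz]

theorem post_tally {Rep : State → Finset (Fin n) → Prop} {a h : ℕ} {act : Prog}
    (hR : Robust Rep a) (hA : Adds π Rep a act) (hh : h = 10 ∨ h = 11) {f : Fin n → ℕ} {s : State}
    (hs : Tallied Rep a (s.reg h) f s) (h4 : s.reg 4 = 1) {u : Fin n} (hu : s.reg 5 = (u : ℕ))
    (hus : (u : ℕ) ∈ s.seen) (hk : s.reg 2 ≤ n) :
    Post π (tally a h act) s fun s' =>
      Tallied Rep a (s.reg h) (fun w => f w + if w ∈ top π (s.reg 2) u then 1 else 0) s' ∧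
        (∀ x, x ∉ scratch → s'.reg x = s.reg x) ∧ s.seen ⊆ s'.seen := by
  unfold tally
  rw [post_seq, post_const]
  have h2 : (s.set 6 0).reg 2 = s.reg 2 := by simp [State.set]
  -- After `j` passes the votes at the first `j` positions of `u` are counted, and register `6`
  -- holds the next position.
  have := post_loop (π := π) (x := 2) (s := s.set 6 0) (p := tallyStep a h act)
    (Inv := fun j s' =>
      Tallied Rep a (s.reg h) (fun w => f w + if w ∈ top π j u then 1 else 0) s' ∧
      s'.reg 6 = j ∧ (∀ x, x ∉ scratch → s'.reg x = s.reg x) ∧ s.seen ⊆ s'.seen) ?_ ?_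
  · rw [h2] at this
    refine this.mono ?_
    rintro s' ⟨r1, -, r3, r4⟩
    exact ⟨r1, r3, r4⟩
  · refine ⟨?_, by simp [State.set], ?_, subset_rfl⟩
    · have h0 : (fun w => f w + if w ∈ top π 0 u then 1 else 0) = f := by
        funext w
        simp [mem_top]
      rw [h0]
      exact ⟨hs.cnt, hs.seen, hR s _ _ (by simp [State.set]) (fun _ _ => rfl) rfl subset_rfl
        hs.rep⟩
    · intro x hx
      simp only [scratch, Finset.mem_insert, Finset.mem_singleton, not_or] at hx
      simp [State.set, hx]
  · rintro j s' hj ⟨r1, r2, r3, r4⟩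
    rw [h2] at hj
    have hsh : s'.reg h = s.reg h := r3 h (by rcases hh with rfl | rfl <;> simp [scratch])
    refine (post_tallyStep (u := u) (z := ⟨j, by omega⟩) hR hA hh (by rw [hsh]; exact r1)
      (by rw [r3 4 (by simp [scratch]), h4]) (by rw [r3 5 (by simp [scratch]), hu]) (r4 hus)
      r2).mono ?_
    rintro s'' ⟨q1, q2, q3, q4⟩
    refine ⟨?_, q2, fun x hx => (q3 x hx).trans (r3 x hx), r4.trans q4⟩
    rw [hsh] at q1
    convert q1 using 1
    funext w
    rw [add_assoc]
    congr 1
    have hw : w = π u ⟨j, by omega⟩ ↔ ((π u).symm w : ℕ) = j := by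
      rw [← Equiv.symm_apply_eq, Fin.ext_iff]
    simp only [mem_top, hw]
    rcases lt_trichotomy ((π u).symm w : ℕ) j with hlt | heq | hgt
    · rw [if_pos (by omega), if_pos hlt, if_neg (by omega)]
    · rw [if_pos (by omega), if_neg (by omega), if_pos heq]
    · rw [if_neg (by omega), if_neg (by omega), if_neg (by omega)]

/-! ### Random members -/

theorem ev_randBelow {r : ℕ} (hr : 0 < r) (G : ℕ → ℝ≥0∞) :
    ev (randBelow r) G = (r : ℝ≥0∞)⁻¹ * ∑ c ∈ Finset.range r, G c := by
  have h : (Finset.range r).Nonempty := Finset.nonempty_range_iff.2 hr.ne'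
  rw [randBelow, dif_pos h, ev_uniformOfFinset, Finset.card_range]

/-- A random entry of a list without repetitions is a random element. -/
theorem ev_uniform_le_ev_randBelow {T : Finset (Fin n)} (hT : T.Nonempty) {r : ℕ}
    (hr : r = T.card) {e : ℕ → ℕ}
    (he : (Finset.range r).image e = T.map Fin.valEmbedding) {g : Fin n → ℝ≥0∞} {G : ℕ → ℝ≥0∞}
    (hG : ∀ c < r, ∀ u ∈ T, e c = u → g u ≤ G c) :
    ev (PMF.uniformOfFinset T hT) g ≤ ev (randBelow r) G := by
  rw [ev_randBelow (hr ▸ hT.card_pos), ev_uniformOfFinset, hr]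
  gcongr
  have hinj : Set.InjOn e (Finset.range r) := by
    rw [← Finset.card_image_iff, he, Finset.card_map, Finset.card_range, hr]
  have hmem : ∀ u ∈ T, ∃ c ∈ Finset.range r, e c = u := by
    intro u hu
    rw [← Finset.mem_image, he]
    exact Finset.mem_map_of_mem _ hu
  choose! i hi hie using hmem
  have hi_inj : Set.InjOn i T := by
    intro u hu u' hu' h
    have h1 := hie u hu
    rw [h, hie u' hu'] at h1
    exact Fin.ext h1.symm
  calc ∑ u ∈ T, g u ≤ ∑ u ∈ T, G (i u) :=
        Finset.sum_le_sum fun u hu => hG _ (Finset.mem_range.1 (hi u hu)) u hu (hie u hu)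
    _ = ∑ c ∈ T.image i, G c := (Finset.sum_image hi_inj).symm
    _ ≤ ∑ c ∈ Finset.range T.card, G c := by
        refine Finset.sum_le_sum_of_subset fun c hc => ?_
        obtain ⟨u, hu, rfl⟩ := Finset.mem_image.1 hc
        rw [← hr]
        exact hi u hu

/-- Drawing a random position below `k` realizes a vote; `k ≤ n` ensures that every such position
exists. -/
theorem ev_vote_le_ev_randBelow {k : ℕ} (hk : 0 < k) (hkn : k ≤ n) (v : Fin n)
    {g : Fin n → ℝ≥0∞} {G : ℕ → ℝ≥0∞} (hG : ∀ c (h : c < n), g (π v ⟨c, h⟩) ≤ G c) :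
    ev (vote π k v) g ≤ ev (randBelow k) G := by
  rw [vote_eq hk]
  refine ev_uniform_le_ev_randBelow _ (by rw [card_top, min_eq_right hkn])
    (e := fun c => if h : c < n then (π v ⟨c, h⟩ : ℕ) else 0) ?_ ?_
  · ext x
    simp only [Finset.mem_image, Finset.mem_range, Finset.mem_map, Fin.valEmbedding_apply, mem_top]
    constructor
    · rintro ⟨c, hc, rfl⟩
      refine ⟨π v ⟨c, by omega⟩, ?_, ?_⟩
      · simpa using hc
      · rw [dif_pos (by omega)]
    · rintro ⟨w, hw, rfl⟩
      refine ⟨_, hw, ?_⟩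
      simp
  · intro c hc u _ hcu
    have hcn : c < n := by omega
    simp only [hcn, dif_pos] at hcu
    rw [← Fin.ext hcu]
    exact hG c hcn

end correctness

/-! ### Success probability and running time of the voting attempts -/

section attempts

variable {n : ℕ} {π : Fin n → Equiv.Perm (Fin n)}

/-! ### One attempt -/

theorem Tallied.congr {Rep : State → Finset (Fin n) → Prop} {a h : ℕ} {f : Fin n → ℕ}
    {s s' : State} (hR : Robust Rep a) (hs : Tallied Rep a h f s) (h9 : s'.reg 9 = s.reg 9)
    (harr : s'.arr = s.arr) (hout : s'.out = s.out) (hseen : s.seen ⊆ s'.seen) :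
    Tallied Rep a h f s' :=
  ⟨fun w => by rw [harr]; exact hs.cnt w, fun w hw => hseen (hs.seen w hw),
    hR s s' _ h9 (fun b _ => by rw [harr]) hout hseen hs.rep⟩

theorem ask_of_mem_seen {s : State} (x : ℕ) {u : Fin n} (hu : (u : ℕ) ∈ s.seen) {z : ℕ}
    (hz : z < n) : s.ask π x u z =
      { (s.set x (π u ⟨z, hz⟩ : ℕ)) with seen := insert (π u ⟨z, hz⟩ : ℕ) s.seen } := by
  unfold State.ask
  rw [dif_pos ⟨hu, u.isLt, hz⟩]

theorem countP_append_singleton (k : ℕ) (U : List (Fin n)) (u w : Fin n) :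
    ((U ++ [u]).countP fun u => decide (w ∈ top π k u)) =
      (U.countP fun u => decide (w ∈ top π k u)) + if w ∈ top π k u then 1 else 0 := by
  rw [List.countP_append, List.countP_singleton]
  simp

/-- The set is stored as a list, and nothing has been done for the second round. -/
def ListRep (j v : ℕ) (out₀ : List (Finset ℕ)) (s : State) (T : Finset (Fin n)) : Prop :=
  s.reg 9 = T.card ∧ (Finset.range T.card).image (s.arr (3 * j + 1)) = T.map Fin.valEmbedding ∧
    s.out = out₀ ∧ (∀ i, s.arr (3 * j + 2) i = 0) ∧ v ∈ s.seen

theorem robust_listRep (j v : ℕ) (out₀ : List (Finset ℕ)) :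
    Robust (n := n) (ListRep j v out₀) (3 * j) := by
  rintro s s' T h9 harr hout hseen ⟨r1, r2, r3, r4, r5⟩
  exact ⟨h9.trans r1, by rw [harr _ (by omega)]; exact r2, hout.trans r3,
    by rw [harr _ (by omega)]; exact r4, hseen r5⟩

theorem adds_push (j v : ℕ) (out₀ : List (Finset ℕ)) :
    Adds π (ListRep j v out₀) (3 * j) (push (3 * j + 1)) := by
  rintro s T w h4 h7 hw ⟨r1, r2, r3, r4, r5⟩
  unfold push
  rw [post_seq, post_store, post_add]
  refine ⟨⟨?_, ?_, r3, ?_, r5⟩, ?_, ?_, ?_, rfl⟩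
  · simp [State.write, State.set, r1, h4, hw]
  · rw [Finset.card_insert_of_notMem hw, Finset.range_add_one, Finset.image_insert,
      Finset.map_insert]
    congr 1
    · simp [State.write, State.set, r1, h7]
    · rw [← r2]
      refine Finset.image_congr fun i hi => ?_
      have hi' : i ≠ T.card := (Finset.mem_range.1 hi).ne
      simp [State.write, State.set, r1, hi']
  · intro i
    simp [State.write, State.set, r4]
  · intro x hx
    simp only [scratch, Finset.mem_insert, Finset.mem_singleton, not_or] at hx
    simp [State.write, State.set, hx]
  · simp [State.write, State.set]
  · simp [State.write, State.set]

/-- The set has been written to the output. -/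
def OutRep (j l : ℕ) (e : ℕ → ℕ) (A : Finset (Fin n)) (out₀ : List (Finset ℕ)) (s : State)
    (T : Finset (Fin n)) : Prop :=
  s.out = T.map Fin.valEmbedding :: out₀ ∧ s.reg 9 = l ∧ s.arr (3 * j + 1) = e ∧
    ∀ u ∈ A, (u : ℕ) ∈ s.seen

theorem robust_outRep (j l : ℕ) (e : ℕ → ℕ) (A : Finset (Fin n)) (out₀ : List (Finset ℕ)) :
    Robust (OutRep j l e A out₀) (3 * j + 2) := by
  rintro s s' T h9 harr hout hseen ⟨r1, r2, r3, r4⟩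
  exact ⟨hout.trans r1, h9.trans r2, by rw [harr _ (by omega)]; exact r3,
    fun u hu => hseen (r4 u hu)⟩

theorem adds_emit (j l : ℕ) (e : ℕ → ℕ) (A : Finset (Fin n)) (out₀ : List (Finset ℕ)) :
    Adds π (OutRep j l e A out₀) (3 * j + 2) (.emit 7) := by
  rintro s T w h4 h7 hw ⟨r1, r2, r3, r4⟩
  rw [post_emit]
  have hput : s.put (s.reg 7) =
      { s with out := insert (w : ℕ) (T.map Fin.valEmbedding) :: out₀ } := by
    unfold State.put
    rw [r1, h7]
  rw [hput]
  exact ⟨⟨by rw [Finset.map_insert]; rfl, r2, r3, r4⟩, fun _ _ => rfl, rfl, rfl, rfl⟩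

/-- The registers that keep their contents in a round. -/
def Kept (x : ℕ) : Prop := x ≠ 5 ∧ x ≠ 14 ∧ x ∉ scratch

/-- The loop simulates independent draws of the walk. Its queries are legal because the seed is
known and the answer to each query becomes known. The invariant ties the counters, and the list of
members above the threshold, to the voters drawn so far. -/
theorem le_wp_firstRound {j k h m : ℕ} {v : Fin n} (hk : 0 < k) (hkn : k ≤ n) (hh : 0 < h)
    {s : State} (h0 : s.reg 0 = v) (h2 : s.reg 2 = k) (h4 : s.reg 4 = 1) (h9 : s.reg 9 = 0)
    (h10 : s.reg 10 = h) (h12 : s.reg 12 = m) (ha : ∀ i, s.arr (3 * j) i = 0)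
    (ha2 : ∀ i, s.arr (3 * j + 2) i = 0) (hv : (v : ℕ) ∈ s.seen) {f : State → ℝ≥0∞}
    {g : List (Fin n) → ℝ≥0∞}
    (hfg : ∀ s' U, (∀ x, Kept x → s'.reg x = s.reg x) →
      Tallied (ListRep j v s.out) (3 * j) h
        (fun w => U.countP fun u => decide (w ∈ top π k u)) s' → g U ≤ f s') :
    ev (iid (walk π k v) m) g ≤ wp π (.loop 12 (firstRoundStep j)) s f := by
  rw [← h12]
  refine ev_iid_le_wp_loop (Inv := fun s' U => (∀ x, Kept x → s'.reg x = s.reg x) ∧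
    Tallied (ListRep j v s.out) (3 * j) h
      (fun w => U.countP fun u => decide (w ∈ top π k u)) s') ?_ ?_ f g
      fun s' W hW => hfg s' W hW.1 hW.2
  · rintro s₁ U ⟨hreg, ht⟩ f g hfg
    have hR := robust_listRep (n := n) j v s.out
    have k0 : s₁.reg 0 = v := (hreg 0 (by simp [Kept, scratch])).trans h0
    have k2 : s₁.reg 2 = k := (hreg 2 (by simp [Kept, scratch])).trans h2
    have k4 : s₁.reg 4 = 1 := (hreg 4 (by simp [Kept, scratch])).trans h4
    have k10 : s₁.reg 10 = h := (hreg 10 (by simp [Kept, scratch])).trans h10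
    unfold walk
    rw [ev_bind]
    simp only [firstRoundStep, wp_seq, wp_rand, wp_query]
    rw [k2]
    refine ev_vote_le_ev_randBelow hk hkn v fun c hc => ?_
    have e1 : (s₁.set 14 c).ask π 5 ((s₁.set 14 c).reg 0) ((s₁.set 14 c).reg 14) =
        { ((s₁.set 14 c).set 5 (π v ⟨c, hc⟩ : ℕ)) with
          seen := insert (π v ⟨c, hc⟩ : ℕ) s₁.seen } := by
      have : (s₁.set 14 c).reg 0 = v := by simp [State.set, k0]
      rw [this, show (s₁.set 14 c).reg 14 = c by simp [State.set]]
      exact ask_of_mem_seen (s := s₁.set 14 c) 5 ht.rep.2.2.2.2 hc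
    rw [e1]
    set u₁ := π v ⟨c, hc⟩
    set s₂ : State := { ((s₁.set 14 c).set 5 (u₁ : ℕ)) with seen := insert (u₁ : ℕ) s₁.seen }
      with hs₂
    rw [show s₂.reg 2 = k by simp [hs₂, State.set, k2]]
    refine ev_vote_le_ev_randBelow hk hkn u₁ fun d hd => ?_
    have e2 : (s₂.set 14 d).ask π 5 ((s₂.set 14 d).reg 5) ((s₂.set 14 d).reg 14) =
        { ((s₂.set 14 d).set 5 (π u₁ ⟨d, hd⟩ : ℕ)) with
          seen := insert (π u₁ ⟨d, hd⟩ : ℕ) s₂.seen } := by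
      have : (s₂.set 14 d).reg 5 = u₁ := by simp [hs₂, State.set]
      rw [this, show (s₂.set 14 d).reg 14 = d by simp [State.set]]
      exact ask_of_mem_seen (s := s₂.set 14 d) 5
        (by simp [hs₂, State.set]) hd
    rw [e2]
    set u := π u₁ ⟨d, hd⟩
    set s₃ : State := { ((s₂.set 14 d).set 5 (u : ℕ)) with seen := insert (u : ℕ) s₂.seen }
      with hs₃
    have hreg₃ : ∀ x, x ≠ 5 → x ≠ 14 → s₃.reg x = s₁.reg x := by
      intro x hx5 hx14
      simp [hs₃, hs₂, State.set, hx5, hx14]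
    have hseen₃ : s₁.seen ⊆ s₃.seen :=
      (Finset.subset_insert _ _).trans (Finset.subset_insert _ _)
    have ht₃ := ht.congr hR (hreg₃ 9 (by norm_num) (by norm_num)) (s' := s₃) rfl rfl hseen₃
    have l10 : s₃.reg 10 = h := (hreg₃ 10 (by norm_num) (by norm_num)).trans k10
    have l2 : s₃.reg 2 = k := (hreg₃ 2 (by norm_num) (by norm_num)).trans k2
    rw [← l10] at ht₃
    refine (post_tally (u := u) hR (adds_push j v s.out) (Or.inl rfl) ht₃
      ((hreg₃ 4 (by norm_num) (by norm_num)).trans k4) (by simp [hs₃, State.set])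
      (Finset.mem_insert_self _ _) (by rw [l2]; exact hkn)).le_wp fun s' hs' => hfg s' u ?_
    refine ⟨fun x hx => ?_, ?_⟩
    · rw [hs'.2.1 x hx.2.2, hreg₃ x hx.1 hx.2.1, hreg x hx]
    · rw [l10, l2] at hs'
      simp only [countP_append_singleton]
      exact hs'.1
  · refine ⟨fun _ _ => rfl, fun w => by simp [ha], fun w hw => by simp at hw, ?_⟩
    -- A positive threshold makes the represented set empty at the start, in agreement with the
    -- empty list.
    have : (Finset.univ.filter fun w : Fin n =>
        h ≤ ([] : List (Fin n)).countP fun u => decide (w ∈ top π k u)) = ∅ := by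
      refine Finset.filter_eq_empty_iff.2 fun w _ => ?_
      simp [hh.ne']
    rw [this]
    exact ⟨by simpa using h9, by simp, rfl, ha2, hv⟩

/-- Voters are random list entries, and `hseen` makes asking them legal: they were learnt as answers
in the first round. The set above the threshold is now the output set itself. -/
theorem le_wp_secondRound {j k h m : ℕ} (hkn : k ≤ n) (hh : 0 < h)
    {s : State} {A : Finset (Fin n)} (hA : A.Nonempty) {out₀ : List (Finset ℕ)}
    (h2 : s.reg 2 = k) (h4 : s.reg 4 = 1) (h9 : s.reg 9 = A.card)
    (h11 : s.reg 11 = h) (h13 : s.reg 13 = m) (ha2 : ∀ i, s.arr (3 * j + 2) i = 0)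
    (he : (Finset.range A.card).image (s.arr (3 * j + 1)) = A.map Fin.valEmbedding)
    (hseen : ∀ u ∈ A, (u : ℕ) ∈ s.seen) (hout : s.out = ∅ :: out₀)
    {f : State → ℝ≥0∞} {g : List (Fin n) → ℝ≥0∞}
    (hfg : ∀ s' W, s'.out = (popular π k h W).map Fin.valEmbedding :: out₀ → g W ≤ f s') :
    ev (iid (PMF.uniformOfFinset A hA) m) g ≤ wp π (.loop 13 (secondRoundStep j)) s f := by
  rw [← h13]
  set e := s.arr (3 * j + 1) with hedef
  refine ev_iid_le_wp_loop (Inv := fun s' U => (∀ x, Kept x → s'.reg x = s.reg x) ∧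
    Tallied (OutRep j A.card e A out₀) (3 * j + 2) h
      (fun w => U.countP fun u => decide (w ∈ top π k u)) s') ?_ ?_ f g
      fun s' W hW => hfg s' W hW.2.rep.1
  · rintro s₁ U ⟨hreg, ht⟩ f g hfg
    have hR := robust_outRep j A.card e A out₀
    have k2 : s₁.reg 2 = k := (hreg 2 (by simp [Kept, scratch])).trans h2
    have k4 : s₁.reg 4 = 1 := (hreg 4 (by simp [Kept, scratch])).trans h4
    have k11 : s₁.reg 11 = h := (hreg 11 (by simp [Kept, scratch])).trans h11
    obtain ⟨-, k9, karr, kseen⟩ := ht.rep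
    simp only [secondRoundStep, wp_seq, wp_rand, wp_load]
    rw [k9]
    refine ev_uniform_le_ev_randBelow hA rfl he fun c _ u hu hcu => ?_
    set s₃ : State := (s₁.set 14 c).set 5
      ((s₁.set 14 c).arr (3 * j + 1) ((s₁.set 14 c).reg 14)) with hs₃
    have hreg₃ : ∀ x, x ≠ 5 → x ≠ 14 → s₃.reg x = s₁.reg x := by
      intro x hx5 hx14
      simp [hs₃, State.set, hx5, hx14]
    have l5 : s₃.reg 5 = u := by
      simp [hs₃, State.set, karr, hcu]
    have ht₃ := ht.congr hR (hreg₃ 9 (by norm_num) (by norm_num)) (s' := s₃) rfl rfl subset_rfl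
    have l11 : s₃.reg 11 = h := (hreg₃ 11 (by norm_num) (by norm_num)).trans k11
    have l2 : s₃.reg 2 = k := (hreg₃ 2 (by norm_num) (by norm_num)).trans k2
    rw [← l11] at ht₃
    refine (post_tally (u := u) hR (adds_emit j A.card e A out₀) (Or.inr rfl) ht₃
      ((hreg₃ 4 (by norm_num) (by norm_num)).trans k4) l5
      (kseen u hu) (by rw [l2]; exact hkn)).le_wp fun s' hs' => hfg s' u ?_
    refine ⟨fun x hx => ?_, ?_⟩
    · rw [hs'.2.1 x hx.2.2, hreg₃ x hx.1 hx.2.1, hreg x hx]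
    · rw [l11, l2] at hs'
      simp only [countP_append_singleton]
      exact hs'.1
  · refine ⟨fun _ _ => rfl, fun w => by simp [ha2], fun w hw => by simp at hw, ?_⟩
    have : (Finset.univ.filter fun w : Fin n =>
        h ≤ ([] : List (Fin n)).countP fun u => decide (w ∈ top π k u)) = ∅ := by
      refine Finset.filter_eq_empty_iff.2 fun w _ => ?_
      simp [hh.ne']
    rw [this]
    exact ⟨by simpa using hout, h9, rfl, hseen⟩

/-- The state before the last `j` attempts: the parameters are in their registers, and the arrays of
these attempts are empty. -/
structure Ready (v k h₂ h₃ m₂ m₃ j : ℕ) (s : State) : Prop where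
  reg0 : s.reg 0 = v
  reg2 : s.reg 2 = k
  reg4 : s.reg 4 = 1
  reg10 : s.reg 10 = h₂
  reg11 : s.reg 11 = h₃
  reg12 : s.reg 12 = m₂
  reg13 : s.reg 13 = m₃
  seen : v ∈ s.seen
  arr : ∀ a < 3 * j, ∀ i, s.arr a i = 0

theorem le_prob_attempt {k h₂ h₃ m₂ m₃ j : ℕ} {v : Fin n} (hk : 0 < k) (hkn : k ≤ n)
    (hh₂ : 0 < h₂) (hh₃ : 0 < h₃) {s : State} (hs : Ready v k h₂ h₃ m₂ m₃ (j + 1) s)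
    (S : Finset (Fin n)) :
    ev (iid (walk π k v) m₂) (fun U => secondRound π k h₃ m₃ S (popular π k h₂ U)) ≤
      prob (exec π (.seq .newSet (attemptBody j)) s)
        {x | S.map Fin.valEmbedding ∈ x.1.out} := by
  have hw : prob (exec π (.seq .newSet (attemptBody j)) s)
      {x | S.map Fin.valEmbedding ∈ x.1.out} = wp π (.seq .newSet (attemptBody j)) s
        fun s' => if S.map Fin.valEmbedding ∈ s'.out then 1 else 0 := by
    rw [prob_eq_ev, wp]
    congr 1
    funext x
    by_cases h : S.map Fin.valEmbedding ∈ x.1.out <;> simp [h]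
  rw [hw]
  simp only [attemptBody, wp_seq, wp_newSet, wp_const]
  set s₁ : State := State.set { s with out := ∅ :: s.out } 9 0 with hs₁
  have hreg : ∀ x, x ≠ 9 → s₁.reg x = s.reg x := fun x hx => by simp [hs₁, State.set, hx]
  refine le_wp_firstRound hk hkn hh₂ ((hreg 0 (by norm_num)).trans hs.reg0)
    ((hreg 2 (by norm_num)).trans hs.reg2) ((hreg 4 (by norm_num)).trans hs.reg4)
    (by simp [hs₁, State.set]) ((hreg 10 (by norm_num)).trans hs.reg10)
    ((hreg 12 (by norm_num)).trans hs.reg12) (hs.arr _ (by omega)) (hs.arr _ (by omega)) hs.seen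
    fun s' U hreg' ht => ?_
  unfold secondRound
  split_ifs with hne
  swap
  · exact bot_le
  rw [prob_eq_ev]
  obtain ⟨r1, r2, r3, r4, -⟩ := ht.rep
  have hreg'' : ∀ x, x ≠ 9 → Kept x → s'.reg x = s.reg x := fun x hx hx' =>
    (hreg' x hx').trans (hreg x hx)
  refine le_wp_secondRound (out₀ := s.out) hkn hh₃ hne
    ((hreg'' 2 (by norm_num) (by simp [Kept, scratch])).trans hs.reg2)
    ((hreg'' 4 (by norm_num) (by simp [Kept, scratch])).trans hs.reg4) r1
    ((hreg'' 11 (by norm_num) (by simp [Kept, scratch])).trans hs.reg11)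
    ((hreg'' 13 (by norm_num) (by simp [Kept, scratch])).trans hs.reg13) r4 r2 ?_ r3
    fun s'' W hW => ?_
  · intro u hu
    exact ht.seen u (hh₂.trans_le (Finset.mem_filter.1 hu).2)
  · by_cases hWS : popular π k h₃ W = S
    · have : S.map Fin.valEmbedding ∈ s''.out := by simp [hW, hWS]
      simp [hWS, this]
    · simp [hWS]

/-! ### Repeated attempts -/

/-- The registers that keep their contents in all attempts. -/
def fixedRegs : Finset ℕ := {0, 1, 2, 3, 4, 10, 11, 12, 13}

/-- Attempts run with decreasing `j` and write only to arrays of index at least `3 * j`. The later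
ones thus find their arrays still zero, and no time is spent on clearing. -/
theorem frame_attemptBody (j : ℕ) : Frame fixedRegs {a | a < 3 * j} (attemptBody j) := by
  simp [attemptBody, firstRoundStep, secondRoundStep, tally, tallyStep, push, Frame, fixedRegs]

theorem cost_attemptBody (r : ℕ → ℕ) (j : ℕ) : cost r (attemptBody j) =
    3 + r 12 * (10 * r 2 + 7) + r 13 * (9 * r 2 + 5) := by
  simp only [attemptBody, firstRoundStep, secondRoundStep, tally, tallyStep, push, cost]
  norm_num
  ring

theorem attempt_framed {j : ℕ} {s : State} :
    ∀ x ∈ (exec π (.seq .newSet (attemptBody j)) s).support,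
      Framed fixedRegs {a | a < 3 * j} { s with out := ∅ :: s.out } x.1 ∧
        x.2 ≤ 4 + s.reg 12 * (10 * s.reg 2 + 7) + s.reg 13 * (9 * s.reg 2 + 5) := by
  intro x hx
  simp only [exec, PMF.mem_support_bind_iff, PMF.mem_support_map_iff, PMF.mem_support_pure_iff]
    at hx
  obtain ⟨_, rfl, y, hy, rfl⟩ := hx
  obtain ⟨h1, h2⟩ := framed_of_mem_support _ (frame_attemptBody j) _ y hy
  refine ⟨h1, ?_⟩
  rw [cost_attemptBody] at h2
  show 1 + y.2 ≤ _
  change y.2 ≤ 3 + s.reg 12 * (10 * s.reg 2 + 7) + s.reg 13 * (9 * s.reg 2 + 5) at h2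
  omega

theorem attempts_time (j : ℕ) : ∀ s, ∀ x ∈ (exec π (attempts j) s).support,
    x.2 ≤ 1 + j * (4 + s.reg 12 * (10 * s.reg 2 + 7) + s.reg 13 * (9 * s.reg 2 + 5)) ∧
      x.1.out.length ≤ s.out.length + j := by
  induction j with
  | zero =>
    intro s x hx
    simp only [attempts, exec, PMF.mem_support_pure_iff] at hx
    subst hx
    simp [State.set]
  | succ j ih =>
    intro s x hx
    rw [attempts, exec] at hx
    simp only [PMF.mem_support_bind_iff, PMF.mem_support_map_iff] at hx
    obtain ⟨y, hy, z, hz, rfl⟩ := hx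
    obtain ⟨h1, h2⟩ := attempt_framed y hy
    obtain ⟨h3, h4⟩ := ih y.1 z hz
    rw [h1.reg 12 (by simp [fixedRegs]), h1.reg 13 (by simp [fixedRegs]),
      h1.reg 2 (by simp [fixedRegs])] at h3
    obtain ⟨A, hA⟩ := h1.out _ _ rfl
    rw [hA, List.length_cons] at h4
    change y.2 + z.2 ≤ _ ∧ z.1.out.length ≤ _
    refine ⟨?_, by omega⟩
    rw [add_mul, one_mul]
    change z.2 ≤ 1 + j * (4 + s.reg 12 * (10 * s.reg 2 + 7) + s.reg 13 * (9 * s.reg 2 + 5)) at h3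
    omega

/-- Each attempt opens a new set and changes only that set, so earlier output is never damaged. -/
theorem post_attempts_mem_out (j : ℕ) (A : Finset ℕ) : ∀ s, A ∈ s.out →
    Post π (attempts j) s fun s' => A ∈ s'.out := by
  induction j with
  | zero =>
    intro s hs
    rw [attempts, post_const]
    exact hs
  | succ j ih =>
    intro s hs
    rw [attempts, post_seq]
    intro x hx
    obtain ⟨A', hA'⟩ := (attempt_framed x hx).1.out _ _ rfl
    exact ih x.1 (by rw [hA']; exact List.mem_cons_of_mem _ hs)

/-- The probability that all attempts fail. -/
theorem wp_attempts_le {k h₂ h₃ m₂ m₃ : ℕ} {v : Fin n} (hk : 0 < k) (hkn : k ≤ n)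
    (hh₂ : 0 < h₂) (hh₃ : 0 < h₃) {S : Finset (Fin n)} {q : ℝ≥0∞}
    (hq : q ≤ ev (iid (walk π k v) m₂) fun U => secondRound π k h₃ m₃ S (popular π k h₂ U))
    (j : ℕ) : ∀ s, Ready v k h₂ h₃ m₂ m₃ j s →
      wp π (attempts j) s (fun s' => if S.map Fin.valEmbedding ∈ s'.out then 0 else 1) ≤
        (1 - q) ^ j := by
  induction j with
  | zero =>
    intro s hs
    rw [attempts, wp_const, pow_zero]
    split_ifs <;> simp
  | succ j ih =>
    intro s hs
    rw [attempts, wp_seq]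
    have h1 := prob_compl_le (hq.trans (le_prob_attempt (π := π) hk hkn hh₂ hh₃ hs S))
    rw [prob_eq_ev] at h1
    rw [pow_succ]
    refine le_trans ?_ (mul_le_mul_right h1 _)
    rw [← ev_const_mul]
    refine ev_mono_support fun x hx => ?_
    have hf := (attempt_framed x hx).1
    -- After a success the probability of overall failure is zero; after a failure the remaining
    -- attempts start from a ready state, whatever the failed one left behind.
    by_cases hS : S.map Fin.valEmbedding ∈ x.1.out
    · refine le_trans ((post_attempts_mem_out (π := π) j _ x.1 hS).wp_le_const (e := 0)
        fun s' hs' => ?_) bot_le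
      rw [if_pos hs']
    · rw [if_pos (by exact hS), mul_one]
      refine ih x.1 ⟨?_, ?_, ?_, ?_, ?_, ?_, ?_, hf.seen hs.seen, fun a ha i => ?_⟩
      · exact (hf.reg 0 (by simp [fixedRegs])).trans hs.reg0
      · exact (hf.reg 2 (by simp [fixedRegs])).trans hs.reg2
      · exact (hf.reg 4 (by simp [fixedRegs])).trans hs.reg4
      · exact (hf.reg 10 (by simp [fixedRegs])).trans hs.reg10
      · exact (hf.reg 11 (by simp [fixedRegs])).trans hs.reg11
      · exact (hf.reg 12 (by simp [fixedRegs])).trans hs.reg12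
      · exact (hf.reg 13 (by simp [fixedRegs])).trans hs.reg13
      · rw [hf.arr a ha]
        exact hs.arr a (by omega) i

/-! ### The parameters -/

/-- Of the two bounds on `2 ^ l`, the lower one is for the error of the second round and the upper
one keeps `l` of order `log t` for the running time. -/
theorem post_setup {h m v t k : ℕ} (ht : 0 < t) (N : ℕ) :
    ∀ x ∈ (exec π (setup h m) (initial v t k)).support, ∃ l, t < 2 ^ l ∧ 2 ^ l ≤ 2 * t ∧
      Ready v k h (h * l) m (m * l) N x.1 ∧ x.1.out = [] ∧
        x.2 ≤ 4 * t + 2 * h + 2 * m + 7 := by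
  have htime : ∀ x ∈ (exec π (setup h m) (initial v t k)).support,
      x.2 ≤ 4 * t + 2 * h + 2 * m + 7 := by
    intro x hx
    rw [setup, exec] at hx
    simp only [PMF.mem_support_bind_iff, PMF.mem_support_map_iff] at hx
    obtain ⟨y, hy, z, hz, rfl⟩ := hx
    have h1 : Post π (setupLength h m) (initial v t k) fun s => s.reg 10 = h ∧ s.reg 12 = m := by
      unfold setupLength
      simp only [post_seq, post_const]
      refine (post_loop (Inv := fun _ _ => True) trivial fun _ s _ _ x _ => trivial).mono
        fun s _ => ?_
      simp [State.set]
    have h2 := (framed_of_mem_support (F := {1}) (G := ∅) (setupLength h m)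
      (by simp [setupLength, Frame]) _ y hy).2
    have h3 := (framed_of_mem_support (F := {10, 12}) (G := ∅) setupRound
      (by simp [setupRound, Frame]) _ z hz).2
    obtain ⟨h4, h5⟩ := h1 y hy
    simp only [setupLength, setupRound, cost, h4, h5] at h2 h3
    have h6 : (initial v t k).reg 1 = t := rfl
    rw [h6] at h2
    norm_num at h2 h3
    show y.2 + z.2 ≤ _
    omega
  have hpost : Post π (setup h m) (initial v t k) fun s => ∃ l, t < 2 ^ l ∧ 2 ^ l ≤ 2 * t ∧
      Ready v k h (h * l) m (m * l) N s ∧ s.out = [] := by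
    unfold setup setupLength setupRound
    simp only [post_seq, post_const]
    -- Either the doubling has passed `t`, or it has happened in every pass so far.
    refine (post_loop (x := 1) (Inv := fun j s => ∃ l, s.reg 3 = l ∧ s.reg 16 = 2 ^ l ∧
      2 ^ l ≤ 2 * t ∧ (t < 2 ^ l ∨ l = j) ∧ s.reg 0 = v ∧ s.reg 1 = t ∧ s.reg 2 = k ∧
      s.reg 4 = 1 ∧ s.reg 11 = 0 ∧ s.reg 13 = 0 ∧ s.seen = {v} ∧ (∀ a i, s.arr a i = 0) ∧
      s.out = []) ?_ ?_).mono ?_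
    · refine ⟨0, ?_⟩
      simp [State.set, initial]
      omega
    · rintro j s - ⟨l, r3, r16, hl, hlj, r0, r1, r2, r4, r11, r13, hseen, harr, hout⟩
      rw [post_ite, r16, r1]
      split_ifs with hc
      · rw [post_seq, post_add, post_add]
        refine ⟨l + 1, ?_⟩
        simp [State.set, r3, r4, r16, r0, r1, r2, r11, r13, hseen, harr, hout]
        omega
      · rw [post_const]
        refine ⟨l, ?_⟩
        simp [State.set, r3, r4, r16, r0, r1, r2, r11, r13, hseen, harr, hout, hl]
        omega
    · rintro s ⟨l, r3, r16, hl, hlj, r0, r1, r2, r4, r11, r13, hseen, harr, hout⟩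
      have hs1 : (((initial v t k).set 4 1).set 16 1).reg 1 = t := by simp [State.set, initial]
      rw [hs1] at hlj
      -- If the doubling never stopped, then `l = t`, and `t < 2 ^ t`.
      have hl2 : t < 2 ^ l := by
        rcases hlj with hlj | rfl
        · exact hlj
        · exact Nat.lt_two_pow_self
      refine (post_loop (x := 10) (Inv := fun j s => s.reg 11 = j * l ∧ s.reg 3 = l ∧
        s.reg 0 = v ∧ s.reg 2 = k ∧ s.reg 4 = 1 ∧ s.reg 10 = h ∧ s.reg 12 = m ∧ s.reg 13 = 0 ∧
        s.seen = {v} ∧ (∀ a i, s.arr a i = 0) ∧ s.out = []) ?_ ?_).mono ?_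
      · simp [State.set, r3, r0, r2, r4, r11, r13, hseen, harr, hout]
      · rintro j s - ⟨r11, r3, r0, r2, r4, r10, r12, r13, hseen, harr, hout⟩
        rw [post_add]
        simp [State.set, r3, r0, r2, r4, r10, r11, r12, r13, hseen, harr, hout, add_mul]
      · rintro s' ⟨r11, r3, r0, r2, r4, r10, r12', r13, hseen, harr, hout⟩
        rw [show ((s.set 10 h).set 12 m).reg 10 = h by simp [State.set]] at r11
        refine (post_loop (x := 12) (Inv := fun j s => s.reg 13 = j * l ∧ s.reg 3 = l ∧
          s.reg 0 = v ∧ s.reg 2 = k ∧ s.reg 4 = 1 ∧ s.reg 10 = h ∧ s.reg 12 = m ∧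
          s.reg 11 = h * l ∧ s.seen = {v} ∧ (∀ a i, s.arr a i = 0) ∧ s.out = []) ?_ ?_).mono ?_
        · simp [r3, r0, r2, r4, r10, r11, r12', r13, hseen, harr, hout]
        · rintro j s - ⟨r13, r3, r0, r2, r4, r10, r12, r11, hseen, harr, hout⟩
          rw [post_add]
          simp [State.set, r3, r0, r2, r4, r10, r11, r12, r13, hseen, harr, hout, add_mul]
        · rintro s'' ⟨r13, r3, r0, r2, r4, r10, r12, r11, hseen, harr, hout⟩
          rw [r12'] at r13
          exact ⟨l, hl2, hl, ⟨r0, r2, r4, r10, r11, r12, r13, by simp [hseen],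
            fun a _ i => harr a i⟩, hout⟩
  intro x hx
  obtain ⟨l, h1, h2, h3, h4⟩ := hpost x hx
  exact ⟨l, h1, h2, h3, h4, htime x hx⟩

end attempts

/-! ### Choice of the constants and analysis of the whole program -/

section localProg

variable {n : ℕ} {π : Fin n → Equiv.Perm (Fin n)}

theorem quota_le {θ : ℝ} (hθ : 0 < θ) {t : ℕ} (ht : 0 < t) : (quota θ t : ℝ) ≤ (θ + 1) * t := by
  have h1 : (1 : ℝ) ≤ t := by exact_mod_cast ht
  have h2 : (quota θ t : ℝ) < θ * t + 1 := Nat.ceil_lt_add_one (by positivity)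
  linarith

/-- The machine is given the quota cut off at `n`, which changes no vote; this and its companions
transfer the estimates for the full quota. -/
theorem popular_min (π : Fin n → Equiv.Perm (Fin n)) (k h : ℕ) (U : List (Fin n)) :
    popular π (min k n) h U = popular π k h U := by
  simp only [popular, top_min]

theorem secondRound_min (π : Fin n → Equiv.Perm (Fin n)) (k h m : ℕ) (S A : Finset (Fin n)) :
    secondRound π (min k n) h m S A = secondRound π k h m S A := by
  simp only [secondRound, popular_min]

theorem vote_min (π : Fin n → Equiv.Perm (Fin n)) (k : ℕ) : vote π (min k n) = vote π k := by
  funext v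
  simp only [vote, top_min]

theorem walk_min (π : Fin n → Equiv.Perm (Fin n)) (k : ℕ) (v : Fin n) :
    walk π (min k n) v = walk π k v := by
  rw [walk, walk, vote_min]

/-- The numbers of votes, of voters and of attempts can be chosen in terms of the constants. -/
theorem exists_parameters {θ α β δ η B : ℝ} (hθ : 0 < θ) (hβ : 0 ≤ β) (hη : 0 < η)
    (hη8 : α - β = 8 * η) (hB : 0 < B) :
    ∃ (h m N : ℕ) (c : ℝ), 0 < h ∧ 0 < m ∧ (h : ℝ) = c * m ∧ β + 3 * η ≤ c ∧ c + 3 * η ≤ α ∧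
      (1 + (θ + 1) * (2 / η)) * Real.exp (-(m * η ^ 2 / 4)) ≤ η / 2 ∧
      (1 + (θ + 1) * (2 / η)) * Real.exp (-(m * η ^ 2 / 4)) ≤ 1 / 4 ∧
      Real.log (1 / δ) ≤ (1 / B) ^ m / 4 * N := by
  -- The interval has length `2 η`, because `γ = 8 η`. A rational threshold `r` makes `r m` an
  -- integer once the denominator divides `m`, so the machine needs only integer comparisons.
  obtain ⟨r, hr1, hr2⟩ := exists_rat_btwn (show β + 3 * η < α - 3 * η by linarith)
  set D := 1 + (θ + 1) * (2 / η) with hD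
  have hD0 : 0 < D := by positivity
  have hr0 : (0 : ℝ) < r := by linarith
  have hr0' : 0 < r := by exact_mod_cast hr0
  have hnum : 0 < r.num := Rat.num_pos.2 hr0'
  -- One value of `m` serves both rounds: the first entry is the accuracy for the first round, the
  -- second the decay per unit of `l` in the second round.
  set ε := min (η / (2 * D)) (1 / (4 * D)) with hε
  have hε0 : 0 < ε := lt_min (by positivity) (by positivity)
  set K := ⌈4 / η ^ 2 * Real.log (1 / ε)⌉₊ + 1 with hK
  have hm : 0 < r.den * K := Nat.mul_pos r.den_pos (Nat.succ_pos _)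
  have hexp : Real.exp (-((r.den * K : ℕ) * η ^ 2 / 4)) ≤ ε := by
    have h1 : 4 / η ^ 2 * Real.log (1 / ε) ≤ (r.den * K : ℕ) := by
      refine (Nat.le_ceil _).trans ?_
      have : ⌈4 / η ^ 2 * Real.log (1 / ε)⌉₊ ≤ r.den * K :=
        (Nat.le_succ _).trans (Nat.le_mul_of_pos_left _ r.den_pos)
      exact_mod_cast this
    rw [← Real.le_log_iff_exp_le hε0]
    rw [one_div, Real.log_inv, div_mul_eq_mul_div, div_le_iff₀ (by positivity)] at h1
    linarith
  refine ⟨r.num.toNat * K, r.den * K, ⌈Real.log (1 / δ) / ((1 / B) ^ (r.den * K) / 4)⌉₊, r,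
    Nat.mul_pos (by omega) (Nat.succ_pos _), hm, ?_, hr1.le, by linarith, ?_, ?_, ?_⟩
  · have h1 : ((r.num.toNat : ℕ) : ℝ) = (r.num : ℝ) := by
      exact_mod_cast congrArg (Int.cast : ℤ → ℝ) (Int.toNat_of_nonneg hnum.le)
    have h2 : (r : ℝ) * r.den = r.num := by exact_mod_cast Rat.mul_den_eq_num r
    push_cast
    rw [h1, ← h2]
    ring
  · calc _ ≤ D * (η / (2 * D)) := by
          gcongr
          exact hexp.trans (min_le_left _ _)
      _ = _ := by field_simp
  · calc _ ≤ D * (1 / (4 * D)) := by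
          gcongr
          exact hexp.trans (min_le_right _ _)
      _ = _ := by field_simp
  · rw [← div_le_iff₀' (by positivity)]
    exact Nat.le_ceil _

/-- A bound for the first round, in terms of the constants. -/
theorem first_error_le {θ η : ℝ} (hθ : 0 < θ) (hη : 0 < η) {t : ℕ} (ht : 0 < t) {m : ℕ} {x : ℝ}
    (hD : (1 + (θ + 1) * (2 / η)) * Real.exp (-(m * η ^ 2 / 4)) ≤ x) :
    (t + quota θ t * (2 / η)) * Real.exp (-(m * η ^ 2 / 4)) ≤ x * t := by
  have h1 := quota_le hθ ht
  calc (t + quota θ t * (2 / η)) * Real.exp (-(m * η ^ 2 / 4))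
      ≤ (t + (θ + 1) * t * (2 / η)) * Real.exp (-(m * η ^ 2 / 4)) := by gcongr
    _ = (1 + (θ + 1) * (2 / η)) * Real.exp (-(m * η ^ 2 / 4)) * t := by ring
    _ ≤ x * t := by gcongr

/-- A bound for the second round, whose number of votes grows with the binary length of `t`. -/
theorem second_error_le {θ η : ℝ} (hθ : 0 < θ) (hη : 0 < η) {t : ℕ} (ht : 0 < t) {m l : ℕ}
    (hl : t < 2 ^ l)
    (hD : (1 + (θ + 1) * (2 / η)) * Real.exp (-(m * η ^ 2 / 4)) ≤ 1 / 4) :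
    (t + quota θ t * (2 / η)) * Real.exp (-((m * l : ℕ) * η ^ 2 / 4)) ≤ 1 / 2 := by
  have h1 := quota_le hθ ht
  set D := 1 + (θ + 1) * (2 / η) with hDdef
  have hD1 : 1 ≤ D := by
    rw [hDdef]
    have : 0 < (θ + 1) * (2 / η) := by positivity
    linarith
  have hl0 : l ≠ 0 := by
    rintro rfl
    simp at hl
    omega
  have hx : Real.exp (-(m * η ^ 2 / 4)) ≤ 1 / (4 * D) := by
    rw [le_div_iff₀ (by positivity)]
    linarith
  have hexp : Real.exp (-((m * l : ℕ) * η ^ 2 / 4)) = Real.exp (-(m * η ^ 2 / 4)) ^ l := by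
    rw [← Real.exp_nat_mul]
    congr 1
    push_cast
    ring
  have htl : (t : ℝ) ≤ 2 ^ l := by exact_mod_cast hl.le
  -- The decay `(4 D)⁻ˡ` beats `t ≤ 2 ^ l` and leaves `(2 D)⁻ˡ`; since `l ≥ 1` and `D ≥ 1`, one
  -- factor absorbs the `D` in front.
  calc (t + quota θ t * (2 / η)) * Real.exp (-((m * l : ℕ) * η ^ 2 / 4))
      ≤ (t + (θ + 1) * t * (2 / η)) * Real.exp (-((m * l : ℕ) * η ^ 2 / 4)) := by gcongr
    _ = D * (t * Real.exp (-(m * η ^ 2 / 4)) ^ l) := by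
        rw [hexp, hDdef]
        ring
    _ ≤ D * (2 ^ l * (1 / (4 * D)) ^ l) := by gcongr
    _ = D * (1 / (2 * D)) ^ l := by
        rw [← mul_pow]
        congr 2
        field_simp
        norm_num
    _ ≤ D * (1 / (2 * D)) := by
        gcongr
        refine pow_le_of_le_one (by positivity) ?_ hl0
        rw [div_le_one (by positivity)]
        linarith
    _ = 1 / 2 := by field_simp

/-- Since `k ≤ (θ + 1) t`, the walk law is at least `1 / (B t)` on `S` with `B` independent of `t`.
Each attempt therefore succeeds with probability at least `B⁻ᵐ / 4`, and the number of attempts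
depends on the constants only. -/
theorem le_prob_run {θ α β δ c η B : ℝ} (hθ : 0 < θ) (hβ : 0 ≤ β) (hα1 : α ≤ 1)
    (hα : 1 / 2 < α) (hδ : 0 < δ) (hη : 0 < η) (hη8 : α - β = 8 * η)
    (hB : B = (θ + 1) ^ 2 / (α - 1 / 2)) {h m N : ℕ} (hh : 0 < h) (hm : 0 < m)
    (hhm : (h : ℝ) = c * m) (hc : β + 3 * η ≤ c) (hc' : c + 3 * η ≤ α)
    (hD₂ : (1 + (θ + 1) * (2 / η)) * Real.exp (-(m * η ^ 2 / 4)) ≤ η / 2)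
    (hD₃ : (1 + (θ + 1) * (2 / η)) * Real.exp (-(m * η ^ 2 / 4)) ≤ 1 / 4)
    (hN : Real.log (1 / δ) ≤ (1 / B) ^ m / 4 * N)
    {S : Finset (Fin n)} (hS : S.Nonempty) (hcom : IsCommunity π θ α β S) {v : Fin n}
    (hv : v ∈ goodSeeds π θ α S) :
    ENNReal.ofReal (1 - δ) ≤ prob (run π (localProg h m N) θ S.card v)
      {x | S.map Fin.valEmbedding ∈ x.1.out} := by
  have ht := hS.card_pos
  have ht' : (0 : ℝ) < S.card := by exact_mod_cast ht
  have ha : 0 < α - 1 / 2 := by linarith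
  have hB0 : 0 < B := by
    rw [hB]
    positivity
  have hq := quota_pos hθ ht
  have hw : ∀ u ∈ S, 1 / (B * S.card) ≤ (walk π (quota θ S.card) v u).toReal := by
    intro u hu
    refine le_trans ?_ ((Finset.mem_filter.1 hv).2 u hu)
    rw [threshold_eq ht, le_div_iff₀ (by positivity), div_mul_eq_mul_div, one_mul,
      div_le_iff₀ (by positivity)]
    calc (quota θ S.card : ℝ) ^ 2 ≤ ((θ + 1) * S.card) ^ 2 := by
          gcongr
          exact quota_le hθ ht
      _ = (α - 1 / 2) * S.card * (B * S.card) := by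
          rw [hB]
          generalize α - 1 / 2 = a at ha
          field_simp
  rw [ENNReal.ofReal_sub _ hδ.le, ENNReal.ofReal_one]
  refine one_sub_le_prob ?_
  have h1 : prob (run π (localProg h m N) θ S.card v)
      {x | S.map Fin.valEmbedding ∈ x.1.out}ᶜ =
      wp π (localProg h m N) (initial v S.card (min (quota θ S.card) n))
        fun s => if S.map Fin.valEmbedding ∈ s.out then 0 else 1 := by
    rw [prob_eq_ev, wp, run]
    congr 1
    funext x
    by_cases h : S.map Fin.valEmbedding ∈ x.1.out <;> simp [h]
  rw [h1, localProg, wp_seq]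
  have hpost : Post π (setup h m) (initial v S.card (min (quota θ S.card) n)) fun s =>
      wp π (attempts N) s (fun s' => if S.map Fin.valEmbedding ∈ s'.out then 0 else 1) ≤
        ENNReal.ofReal δ := by
    intro x hx
    obtain ⟨l, hl, -, hready, -, -⟩ := post_setup (π := π) ht N x hx
    have hl0 : 0 < l := by
      rcases Nat.eq_zero_or_pos l with rfl | hl0
      · rw [pow_zero] at hl
        omega
      · exact hl0
    have h2 := le_ev_secondRound (h₃ := h * l) (m₃ := m * l) hS rfl hcom hβ hα1 hη hη8 hc hc' hm
      hhm (Nat.mul_pos hm hl0) (by push_cast; rw [hhm]; ring)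
      ((first_error_le hθ hη ht hD₂).trans_eq (by ring)) (second_error_le hθ hη ht hl hD₃) hB0 hw
    refine (wp_attempts_le (lt_min hq v.pos) (min_le_right _ _) hh (Nat.mul_pos hh hl0)
      (by simpa only [secondRound_min, popular_min, walk_min] using h2) N x.1 hready).trans
      (pow_one_sub_le (by positivity) hδ hN)
  exact hpost.wp_le_const fun s hs => hs

/-- The setup takes `O(t)` steps. An attempt processes `m + m l` voters with `O(k)` steps each,
where `k = O(t)` and `l = O(log t + 1)`. -/
theorem run_time {θ : ℝ} (hθ : 0 < θ) (h m N : ℕ) {t : ℕ} (ht : 1 ≤ t) (v : Fin n) :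
    ∀ x ∈ (run π (localProg h m N) θ t v).support,
      (x.2 : ℝ) ≤ (12 + 2 * h + 2 * m +
        N * (4 + m * (10 * (θ + 1) + 7) + 3 * m * (9 * (θ + 1) + 5))) *
          (t * Real.log t + 1) ∧ x.1.out.length ≤ N := by
  intro x hx
  rw [run, localProg, exec] at hx
  simp only [PMF.mem_support_bind_iff, PMF.mem_support_map_iff] at hx
  obtain ⟨y, hy, z, hz, rfl⟩ := hx
  obtain ⟨l, -, hl, hready, hout, htime⟩ := post_setup (π := π) ht N y hy
  obtain ⟨h1, h2⟩ := attempts_time N y.1 z hz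
  refine ⟨?_, by simpa [hout] using h2⟩
  rw [hready.reg12, hready.reg13, hready.reg2] at h1
  have hk : min (quota θ t) n ≤ quota θ t := min_le_left _ _
  have hk' : ((min (quota θ t) n : ℕ) : ℝ) ≤ (θ + 1) * t :=
    (Nat.cast_le.2 hk).trans (quota_le hθ ht)
  have ht1 : (1 : ℝ) ≤ t := by exact_mod_cast ht
  have ht0 : (0 : ℝ) < t := by linarith
  have hlog0 : 0 ≤ Real.log t := Real.log_nonneg ht1
  -- From `log t ≥ 1 - 1/t`; this absorbs linear terms, also at `t = 1`.
  have htX : (t : ℝ) ≤ t * Real.log t + 1 := by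
    have := Real.one_sub_inv_le_log_of_pos ht0
    have h3 : t * (1 - (t : ℝ)⁻¹) ≤ t * Real.log t := by gcongr
    rw [mul_sub, mul_inv_cancel₀ ht0.ne'] at h3
    linarith
  -- Take logarithms in `2 ^ l ≤ 2 t` and use `log 2 > 1/2`.
  have hlt : (l : ℝ) ≤ 1 + 2 * Real.log t := by
    have h3 : (l : ℝ) * Real.log 2 ≤ Real.log 2 + Real.log t := by
      rw [← Real.log_mul (by norm_num) ht0.ne', ← Real.log_pow]
      exact Real.log_le_log (by positivity) (by exact_mod_cast hl)
    have h4 := Real.log_two_gt_d9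
    nlinarith
  have htl : (t * l : ℝ) ≤ 3 * (t * Real.log t + 1) := by nlinarith
  have htime' : (y.2 : ℝ) ≤ 4 * t + 2 * h + 2 * m + 7 := by exact_mod_cast htime
  have h1' : (z.2 : ℝ) ≤ 1 + N * (4 + m * (10 * (min (quota θ t) n : ℕ) + 7) +
      m * l * (9 * (min (quota θ t) n : ℕ) + 5)) := by exact_mod_cast h1
  set X := t * Real.log t + 1 with hX
  have hX1 : 1 ≤ X := by
    rw [hX]
    nlinarith
  have e1 : (10 * (min (quota θ t) n : ℕ) + 7 : ℝ) ≤ (10 * (θ + 1) + 7) * X := by nlinarith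
  have e2 : (l * (9 * (min (quota θ t) n : ℕ) + 5) : ℝ) ≤ 3 * (9 * (θ + 1) + 5) * X := by
    calc (l * (9 * (min (quota θ t) n : ℕ) + 5) : ℝ) ≤ l * (9 * ((θ + 1) * t) + 5 * t) := by
          gcongr
          linarith
      _ = (9 * (θ + 1) + 5) * (t * l) := by ring
      _ ≤ (9 * (θ + 1) + 5) * (3 * X) := by gcongr
      _ = _ := by ring
  have e3 : (4 + m * (10 * (min (quota θ t) n : ℕ) + 7) +
      m * l * (9 * (min (quota θ t) n : ℕ) + 5) : ℝ) ≤
      (4 + m * (10 * (θ + 1) + 7) + 3 * m * (9 * (θ + 1) + 5)) * X := by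
    calc _ = (4 + m * (10 * (min (quota θ t) n : ℕ) + 7) +
          m * (l * (9 * (min (quota θ t) n : ℕ) + 5)) : ℝ) := by ring
      _ ≤ 4 * X + m * ((10 * (θ + 1) + 7) * X) + m * (3 * (9 * (θ + 1) + 5) * X) := by
          gcongr
          linarith
      _ = _ := by ring
  have e4 : (N : ℝ) * (4 + m * (10 * (min (quota θ t) n : ℕ) + 7) +
      m * l * (9 * (min (quota θ t) n : ℕ) + 5)) ≤
      N * ((4 + m * (10 * (θ + 1) + 7) + 3 * m * (9 * (θ + 1) + 5)) * X) := by gcongr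
  have e5 : (2 * h + 2 * m + 8 : ℝ) ≤ (2 * h + 2 * m + 8) * X :=
    le_mul_of_one_le_right (by positivity) hX1
  show ((y.2 + z.2 : ℕ) : ℝ) ≤ _
  push_cast at h1' ⊢
  push_cast at e4
  linarith

end localProg

end

end Affinity

/-! ### Assembly of the five claims -/

theorem mainTheorem3 :
    -- at least `(2 α - 1) t` members of a community of size `t` are good seeds
    (∀ (θ α β : ℝ), 0 < θ → 0 ≤ β → β < α → α ≤ 1 → 1 / 2 < α →
      ∀ (n : ℕ) (π : Fin n → Equiv.Perm (Fin n)) (S : Finset (Fin n)), S.Nonempty →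
        Affinity.IsCommunity π θ α β S →
          (2 * α - 1) * (S.card : ℝ) ≤ ((Affinity.goodSeeds π θ α S).card : ℝ)) ∧
    -- from a good seed, the exact rough approximation contains `S` and is small, and purification
    -- outputs `S` with probability at least `1 - δ`
    (∃ C : ℝ, 0 < C ∧
      ∀ (θ α β δ : ℝ), 0 < θ → 0 ≤ β → β < α → α ≤ 1 → 1 / 2 < α → 0 < δ → δ < 1 →
      ∀ (n : ℕ) (π : Fin n → Equiv.Perm (Fin n)) (S : Finset (Fin n)), S.Nonempty →
        Affinity.IsCommunity π θ α β S → ∀ v ∈ Affinity.goodSeeds π θ α S,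
        ∀ (t k₂ N₂ : ℕ), t = S.card → k₂ = Affinity.sampleSize C θ α β δ t →
          N₂ = ⌈C * (Affinity.ratio θ t ^ 2 / (α - 1 / 2)) ^ k₂ * Real.log (1 / δ)⌉₊ →
          S ⊆ Affinity.rough π θ α t v ∧
          ((Affinity.rough π θ α t v).card : ℝ) ≤ Affinity.ratio θ t ^ 2 * t / (α - 1 / 2) ∧
          ENNReal.ofReal (1 - δ) ≤
            Affinity.prob (Affinity.purify π θ α β t k₂ N₂ (Affinity.rough π θ α t v))
              {L | S ∈ L}) ∧
    -- the rough approximation found by sampling is always small, and from a good seed it contains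
    -- `S` with probability at least `1 - δ / 2`
    (∀ (θ α β δ : ℝ), 0 < θ → 0 ≤ β → β < α → α ≤ 1 → 1 / 2 < α → 0 < δ → δ < 1 →
      ∀ (n : ℕ) (π : Fin n → Equiv.Perm (Fin n)) (S : Finset (Fin n)), S.Nonempty →
        Affinity.IsCommunity π θ α β S → ∀ (t : ℕ), t = S.card →
          (∀ w : List (Fin n), w.length = Affinity.numDraws θ α δ t →
            ((Affinity.hitSet δ t w).card : ℝ) ≤
              2 * (Affinity.ratio θ t ^ 2 * t / (α - 1 / 2)) + 1) ∧
          ∀ v ∈ Affinity.goodSeeds π θ α S,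
            ENNReal.ofReal (1 - δ / 2) ≤
              Affinity.prob
                (Affinity.iid (Affinity.walk π (Affinity.quota θ t) v)
                  (Affinity.numDraws θ α δ t))
                {w | S ⊆ Affinity.hitSet δ t w}) ∧
    -- sampling and purification from a uniform seed find `S` with probability at least
    -- `(2 α - 1) (1 - δ)`
    (∃ C : ℝ, 0 < C ∧
      ∀ (θ α β δ : ℝ), 0 < θ → 0 ≤ β → β < α → α ≤ 1 → 1 / 2 < α → 0 < δ → δ < 1 →
      ∀ (n : ℕ) (π : Fin n → Equiv.Perm (Fin n)) (S : Finset (Fin n)) (hS : S.Nonempty),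
        Affinity.IsCommunity π θ α β S →
        ∀ (t k₂ N₂ : ℕ), t = S.card → k₂ = Affinity.sampleSize C θ α β δ t →
          N₂ = ⌈(C * Affinity.ratio θ t ^ 2 / (α - 1 / 2)) ^ k₂ * Real.log (2 / δ)⌉₊ →
          ENNReal.ofReal ((2 * α - 1) * (1 - δ)) ≤
            Affinity.prob
              ((PMF.uniformOfFinset S hS).bind (Affinity.sampledLocal π θ α β δ t k₂ N₂))
              {L | S ∈ L}) ∧
    -- for constant parameters, `S` is found from a uniform seed by a program that runs in time
    -- `O(t log t)`, with probability at least `(2 α - 1) (1 - δ)`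
    (∀ (θ α β δ : ℝ), 0 < θ → 0 ≤ β → β < α → α ≤ 1 → 1 / 2 < α → 0 < δ → δ < 1 →
      ∃ (P : Affinity.Prog) (C : ℝ) (N : ℕ),
        ∀ (n : ℕ) (π : Fin n → Equiv.Perm (Fin n)) (t : ℕ), 1 ≤ t →
          (∀ v : Fin n, ∀ x ∈ (Affinity.run π P θ t v).support,
            (x.2 : ℝ) ≤ C * (t * Real.log t + 1) ∧ x.1.out.length ≤ N) ∧
          ∀ (S : Finset (Fin n)) (hS : S.Nonempty), S.card = t →
            Affinity.IsCommunity π θ α β S →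
              ENNReal.ofReal ((2 * α - 1) * (1 - δ)) ≤
                Affinity.prob ((PMF.uniformOfFinset S hS).bind (Affinity.run π P θ t))
                  {x | S.map Fin.valEmbedding ∈ x.1.out}) := by
  refine ⟨?_, ⟨80, by norm_num, ?_⟩, ?_, ⟨80, by norm_num, ?_⟩, ?_⟩
  · intro θ α β hθ _ _ _ _ n π S hS h
    exact Affinity.card_goodSeeds_ge hθ hS h
  · intro θ α β δ hθ hβ hαβ hα1 hα hδ hδ1 n π S hS h v hv t k₂ N₂ ht hk₂ hN₂
    subst ht
    have hcard := Affinity.card_rough_le (π := π) hθ hα hS.card_pos v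
    refine ⟨Affinity.subset_rough hv, hcard, ?_⟩
    have hκ := Affinity.le_ratio hS h
    have hM := Affinity.two_le_ratio_sq_div hα hκ
    refine Affinity.le_prob_purify (B := Affinity.ratio θ S.card ^ 2 / (α - 1 / 2)) hβ hαβ hα1
      (by linarith) hS h (Affinity.subset_rough hv) (hcard.trans_eq (by ring)) ?_ hδ ?_
    · rw [hk₂]
      exact Affinity.exp_sampleSize_le hβ hαβ hα1 hα hδ hδ1 hκ (by linarith) (by linarith)
    · rw [hN₂]
      refine le_trans ?_ (Nat.le_ceil _)
      have hlog : 0 ≤ Real.log (1 / δ) := Real.log_nonneg (by rw [le_div_iff₀ hδ]; linarith)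
      gcongr
      norm_num
  · intro θ α β δ hθ _ _ _ hα hδ hδ1 n π S hS _ t ht
    subst ht
    exact ⟨fun w hw => Affinity.card_hitSet_le hα hδ hδ1 hS.card_pos hw,
      fun v hv => Affinity.le_prob_subset_hitSet hθ hα hδ hδ1 hS hv⟩
  · intro θ α β δ hθ hβ hαβ hα1 hα hδ hδ1 n π S hS h t k₂ N₂ ht hk₂ hN₂
    subst ht
    exact Affinity.le_prob_bind_uniform hθ hS h _ _ (by linarith) fun v hv =>
      Affinity.le_prob_sampledLocal hθ hβ hαβ hα1 hα hδ hδ1 hS h hk₂ hN₂ hv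
  · intro θ α β δ hθ hβ hαβ hα1 hα hδ hδ1
    have ha : 0 < α - 1 / 2 := by linarith
    -- Dividing the gap into eight parts leaves `3 η` on each side of the threshold and an interval
    -- of length `2 η` in which to choose it.
    have hη : 0 < (α - β) / 8 := by linarith
    have hη8 : α - β = 8 * ((α - β) / 8) := by ring
    obtain ⟨k, m, N, c, hk, hm, hkm, hc, hc', hD₂, hD₃, hN⟩ := Affinity.exists_parameters
      (δ := δ) (B := (θ + 1) ^ 2 / (α - 1 / 2)) hθ hβ hη hη8 (by positivity)
    refine ⟨Affinity.localProg k m N, _, N, fun n π t ht =>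
      ⟨fun v => Affinity.run_time hθ k m N ht v, fun S hS hSt h => ?_⟩⟩
    subst hSt
    exact Affinity.le_prob_bind_uniform hθ hS h _ _ (by linarith) fun v hv =>
      Affinity.le_prob_run hθ hβ hα1 hα hδ hη hη8 rfl hk hm hkm hc hc' hD₂ hD₃ hN hS h hv
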